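/- **Theorem (Liouville property for polynomially bounded functions).** Let $\beta\ge 0$. Write $\Lambda(x)=(1+|x|^2)^{1/2}$ on $\mathbb R^n$ and consider complex-valued functions. Put $\mathcal F\phi(\xi)=\widehat\phi(\xi)=(2\pi)^{-n}\int_{\mathbb R^n}e^{-ix\cdot\xi}\phi(x)\,dx$, let $\mathcal F^{-1}$ be the inverse Fourier transform, and let $L^1_\beta(\mathbb R^n)$ be the set of $g\in L^1(\mathbb R^n)$ with $\int|g|\,\Lambda^\beta\,dx<\infty$ and $L^\infty_{-\beta}(\mathbb R^n)$ the set of $f\in L^\infty_{\mathrm{loc}}(\mathbb R^n)$ with $\Lambda^{-\beta}f\in L^\infty(\mathbb R^n)$. Let $m:\mathbb R^n\to\mathbb C$ be continuous, put $\widetilde m(\xi)=m(-\xi)$, and assume that $\phi\mapsto\widetilde m(D)\phi:=\mathcal F^{-1}(\widetilde m\,\widehat\phi)$ maps $C_c^\infty(\mathbb R^n)$ into $L^1_\beta(\mathbb R^n)$; that is, for every $\phi\in C_c^\infty(\mathbb R^n)$ there is a (necessarily a.e. unique) $g=:\widetilde m(D)\phi\in L^1_\beta(\mathbb R^n)$ with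 $\widehat g=\widetilde m\,\widehat\phi$. For $f\in L^\infty_{-\beta}(\mathbb R^n)$, say that $m(D)f=0$ if $$\int_{\mathbb R^n} f(x)\,(\widetilde m(D)\phi)(x)\,dx=0\qquad\text{for all }\phi\in C_c^\infty(\mathbb R^n).$$ 1. If $\{\eta\in\mathbb R^n\mid m(\eta)=0\}\subseteq\{0\}$, then every $f\in L^\infty_{-\beta}(\mathbb R^n)$ with $m(D)f=0$ coincides Lebesgue a.e. with a polynomial (with complex coefficients) of degree at most $\lfloor\beta\rfloor$. 2. Conversely, if every $f\in L^\infty(\mathbb R^n)$ with $m(D)f=0$ coincides Lebesgue a.e. with a polynomial, then $\{\eta\in\mathbb R^n\mid m(\eta)=0\}\subseteq\{0\}$. -/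

import Mathlib

open MeasureTheory
open scoped ContDiff

noncomputable section

namespace Liouville

/-- The space `ℝⁿ` with its Euclidean norm and inner product. -/
abbrev Rn (n : ℕ) : Type := EuclideanSpace ℝ (Fin n)

/-- The weight `Λ(x) = (1 + |x|²)^{1/2}`. -/
def weight {n : ℕ} (x : Rn n) : ℝ := Real.sqrt (1 + ‖x‖ ^ 2)

/-- The Fourier transform `(2π)⁻ⁿ ∫ e^{-i x·ξ} φ(x) dx` of an integrable function. -/
def fourierT {n : ℕ} (φ : Rn n → ℂ) (ξ : Rn n) : ℂ :=
  (((2 * Real.pi) ^ n)⁻¹ : ℝ) *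
    ∫ x : Rn n, Complex.exp (-(Complex.I * ((inner ℝ x ξ : ℝ) : ℂ))) * φ x

/-- `φ ∈ C_c^∞(ℝⁿ)`, complex valued. -/
def IsTestFunction {n : ℕ} (φ : Rn n → ℂ) : Prop :=
  ContDiff ℝ ∞ φ ∧ HasCompactSupport φ

/-- `g ∈ L¹_β(ℝⁿ)`: `g ∈ L¹(ℝⁿ)` and `∫ |g(x)| Λ(x)^β dx < ∞`. -/
def MemL1Weight {n : ℕ} (β : ℝ) (g : Rn n → ℂ) : Prop :=
  Integrable g ∧ Integrable (fun x : Rn n => ‖g x‖ * weight x ^ β)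

/-- `f ∈ L^∞_{-β}(ℝⁿ)`: `f` is measurable and `ess sup Λ(x)^{-β} |f(x)| < ∞`
(such an `f` is automatically locally essentially bounded, `Λ^β` being continuous). -/
def MemLinftyWeight {n : ℕ} (β : ℝ) (f : Rn n → ℂ) : Prop :=
  AEStronglyMeasurable f ∧ MemLp (fun x : Rn n => ((weight x ^ (-β) : ℝ) : ℂ) * f x) ⊤

/-- The reflection `ξ ↦ m(-ξ)` of `m` at the origin. -/
def reflect {n : ℕ} (m : Rn n → ℂ) (ξ : Rn n) : ℂ := m (-ξ)

/-- `g` is (a representative of) `μ(D)φ = F⁻¹(μ · Fφ)` as an element of `L¹(ℝⁿ)`: this says that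
`g` is integrable and `F g = μ · F φ`.  The symbol `μ` is only assumed continuous, so `μ · Fφ`
need not be integrable a priori and `F⁻¹` is the inverse of the (injective) Fourier transform on
`L¹(ℝⁿ)`, which agrees with the inverse Fourier transform of tempered distributions.
Hence `g` is unique up to a null set. -/
def IsMultiplierImage {n : ℕ} (μ : Rn n → ℂ) (φ g : Rn n → ℂ) : Prop :=
  Integrable g ∧ ∀ ξ : Rn n, fourierT g ξ = μ ξ * fourierT φ ξ

/-- The operator `μ(D)` maps `C_c^∞(ℝⁿ)` into `L¹_β(ℝⁿ)`. -/
def MapsTestFunctionsIntoL1Weight {n : ℕ} (β : ℝ) (μ : Rn n → ℂ) : Prop :=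
  ∀ φ : Rn n → ℂ, IsTestFunction φ → ∃ g : Rn n → ℂ, IsMultiplierImage μ φ g ∧ MemL1Weight β g

/-- `m(D) f = 0` as a distribution: `⟨f, m̃(D)φ⟩ = ∫ f · m̃(D)φ dx = 0` for every
`φ ∈ C_c^∞(ℝⁿ)`, where `m̃(ξ) = m(-ξ)`; the integral is required to converge. -/
def IsWeakSolution {n : ℕ} (m f : Rn n → ℂ) : Prop :=
  ∀ φ : Rn n → ℂ, IsTestFunction φ →
    ∃ g : Rn n → ℂ, IsMultiplierImage (reflect m) φ g ∧
      Integrable (fun x : Rn n => f x * g x) ∧ ∫ x : Rn n, f x * g x = 0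

/-- The function on `ℝⁿ` given by a polynomial in `n` variables with complex coefficients. -/
def polyFun {n : ℕ} (p : MvPolynomial (Fin n) ℂ) (x : Rn n) : ℂ :=
  MvPolynomial.eval (fun i => ((x i : ℝ) : ℂ)) p

end Liouville

end

/-!
# Liouville property of Fourier multipliers on polynomially bounded functions

Suppose first that `m` vanishes at most at the origin and that `f`, of growth `(1 + |x|)^β`, solves
`m(D)f = 0`.  The Fourier transform is injective on `L¹`, hence the image under `m̃(D)` of a
translated test function is the translated image, and `f` annihilates all translates of every
`g = m̃(D)φ`.  At a given frequency `ξ₀ ≠ 0` one can choose `φ` so that the Fourier transform of `g`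
does not vanish there.

The symbol is merely continuous, so one cannot divide by it in the sense of distributions; division
is replaced by a weighted version of Wiener's local argument
(`exists_pair_eq_zero_of_support_subset`).  Let `F` be the convolution of `f` with a Schwartz
function whose Fourier transform is supported within a distance of order `ε` of `ξ₀`.  Then `F` is
reproduced by a kernel `v_ε` at scale `1/ε`, and it is annihilated by `g`.  With the normalization
that `g` has Fourier transform `1` at `ξ₀`, the function `F` is minus its convolution with
`g * v_ε - v_ε`.  This kernel is small in `L¹`, but in general not in `L¹` with the weight
`(1 + |x|)^β`.  It is small, however, with the weight `(1 + ε|x|)^β`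
(`tendsto_integral_translationDefect`), which is submultiplicative as well and defines the same
space.  The best constant `M` in `|F(x)| ≤ M (1 + ε|x|)^β` therefore satisfies `M ≤ qM` with
`q < 1`, and `F = 0`.

A partition of unity shows that the Fourier transform of `f` is supported at the origin
(`fourierSupportedAtZero_of_local`).  Consequently `f` coincides almost everywhere with the smooth
function obtained by restricting its frequencies to `|ξ| ≲ ε`, for every `ε`
(`ae_eq_pair_cutoff`).  The derivatives of order `k` of that function are `O(ε^(k - β))`, so they
vanish for `k > β` (`pair_foldr_coordMul_eq_zero`), and a function whose derivatives of order
`⌊β⌋ + 1` vanish is a polynomial of degree at most `⌊β⌋`.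

Conversely, if `m(η) = 0` with `η ≠ 0`, then the plane wave `x ↦ exp(i⟨η, x⟩)` is a bounded solution
that is not a polynomial.
-/

noncomputable section

open Filter Topology
open scoped SchwartzMap FourierTransform

set_option linter.unusedSectionVars false

namespace Liouville

section General

variable {V : Type*} [NormedAddCommGroup V] [InnerProductSpace ℝ V] [FiniteDimensional ℝ V]
  [MeasurableSpace V] [BorelSpace V]

/-! ### Polynomial weights -/

/-- The weight `(1 + |x|)^β`.  It is comparable to `weight x ^ β`, and in contrast to it is exactly
submultiplicative. -/
def polyWeight {E : Type*} [NormedAddCommGroup E] (β : ℝ) (x : E) : ℝ := (1 + ‖x‖) ^ β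

section PolyWeight

variable {E : Type*} [NormedAddCommGroup E] {β : ℝ}

lemma polyWeight_pos (β : ℝ) (x : E) : 0 < polyWeight β x := by
  unfold polyWeight; positivity

lemma polyWeight_nonneg (β : ℝ) (x : E) : 0 ≤ polyWeight β x := (polyWeight_pos β x).le

@[simp] lemma polyWeight_zero (β : ℝ) : polyWeight β (0 : E) = 1 := by simp [polyWeight]

lemma one_le_polyWeight (hβ : 0 ≤ β) (x : E) : 1 ≤ polyWeight β x :=
  Real.one_le_rpow (by linarith [norm_nonneg x]) hβ

lemma polyWeight_mono (hβ : 0 ≤ β) {x y : E} (h : ‖x‖ ≤ ‖y‖) : polyWeight β x ≤ polyWeight β y := by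
  unfold polyWeight; gcongr

lemma polyWeight_add_le (hβ : 0 ≤ β) (x y : E) :
    polyWeight β (x + y) ≤ polyWeight β x * polyWeight β y := by
  unfold polyWeight
  rw [← Real.mul_rpow (by positivity) (by positivity)]
  gcongr
  nlinarith [norm_add_le x y, mul_nonneg (norm_nonneg x) (norm_nonneg y)]

lemma continuous_polyWeight (β : ℝ) : Continuous (polyWeight β : E → ℝ) := by
  unfold polyWeight
  refine Continuous.rpow_const (by fun_prop) fun x => Or.inl ?_
  positivity

lemma polyWeight_smul_le_polyWeight [NormedSpace ℝ E] (hβ : 0 ≤ β) {ε : ℝ} (h0 : 0 ≤ ε)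
    (h1 : ε ≤ 1) (x : E) : polyWeight β (ε • x) ≤ polyWeight β x := by
  refine polyWeight_mono hβ ?_
  rw [norm_smul, Real.norm_of_nonneg h0]
  exact mul_le_of_le_one_left (norm_nonneg x) h1

lemma polyWeight_smul_le [NormedSpace ℝ E] (hβ : 0 ≤ β) {R : ℝ} (h1 : 1 ≤ R) (x : E) :
    polyWeight β (R • x) ≤ R ^ β * polyWeight β x := by
  unfold polyWeight
  rw [← Real.mul_rpow (by positivity) (by positivity), norm_smul,
    Real.norm_of_nonneg (by positivity)]
  gcongr
  linarith

end PolyWeight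

/-- Membership in the weighted space `L¹_β`, formulated with `polyWeight`. -/
structure WeightedIntegrable (β : ℝ) (k : V → ℂ) : Prop where
  aestronglyMeasurable : AEStronglyMeasurable k
  integrable_mul : Integrable fun x => polyWeight β x * ‖k x‖

/-- A measurable function that is everywhere bounded by a multiple of `(1 + |x|)^β`. -/
structure PolyBounded (β : ℝ) (f : V → ℂ) : Prop where
  measurable : Measurable f
  exists_bound : ∃ C, 0 ≤ C ∧ ∀ x, ‖f x‖ ≤ C * polyWeight β x

/-- The correlation `a ↦ ∫ f(a + x) k(x) dx`, that is, the convolution of `f` with the reflection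
of `k`. -/
def corr (f k : V → ℂ) (a : V) : ℂ := ∫ x, f (a + x) * k x

variable {β : ℝ} {f k : V → ℂ}

lemma WeightedIntegrable.integrable (hβ : 0 ≤ β) (hk : WeightedIntegrable β k) : Integrable k :=
  hk.integrable_mul.mono' hk.aestronglyMeasurable <| Eventually.of_forall fun x =>
    le_mul_of_one_le_left (norm_nonneg _) (one_le_polyWeight hβ x)

lemma integrable_mul_of_norm_le {F : V → ℂ} (hF : Measurable F) {C : ℝ}
    (hFC : ∀ x, ‖F x‖ ≤ C * polyWeight β x) (hk : WeightedIntegrable β k) :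
    Integrable fun x => F x * k x := by
  refine (hk.integrable_mul.const_mul C).mono'
    (hF.aestronglyMeasurable.mul hk.aestronglyMeasurable) <| Eventually.of_forall fun x => ?_
  rw [norm_mul, ← mul_assoc]
  gcongr
  exact hFC x

lemma PolyBounded.exists_bound_add (hβ : 0 ≤ β) (hf : PolyBounded β f) :
    ∃ C, 0 ≤ C ∧ ∀ a x, ‖f (a + x)‖ ≤ C * polyWeight β a * polyWeight β x := by
  obtain ⟨C, hC, h⟩ := hf.exists_bound
  refine ⟨C, hC, fun a x => (h _).trans ?_⟩
  rw [mul_assoc]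
  gcongr
  exact polyWeight_add_le hβ a x

lemma PolyBounded.integrable_mul (hβ : 0 ≤ β) (hf : PolyBounded β f)
    (hk : WeightedIntegrable β k) (a : V) : Integrable fun x => f (a + x) * k x := by
  obtain ⟨C, hC, h⟩ := hf.exists_bound_add hβ
  exact integrable_mul_of_norm_le (hf.measurable.comp (measurable_const_add a)) (h a) hk

lemma norm_corr_le {C : ℝ} {a : V} (hk : WeightedIntegrable β k)
    (h : ∀ x, ‖f (a + x)‖ ≤ C * polyWeight β x) :
    ‖corr f k a‖ ≤ C * ∫ x, polyWeight β x * ‖k x‖ := by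
  rw [corr, ← integral_const_mul]
  refine norm_integral_le_of_norm_le (hk.integrable_mul.const_mul C) <|
    Eventually.of_forall fun x => ?_
  rw [norm_mul, ← mul_assoc]
  gcongr
  exact h x

/-! ### Schwartz functions and polynomial weights -/

lemma exists_norm_le_rpow_neg {E : Type*} [NormedAddCommGroup E] [NormedSpace ℝ E]
    (h : 𝓢(V, E)) (r : ℝ) : ∃ C, 0 ≤ C ∧ ∀ x, ‖h x‖ ≤ C * (1 + ‖x‖) ^ (-r) := by
  obtain ⟨N, hN⟩ := exists_nat_ge r
  refine ⟨2 ^ N * (Finset.Iic (N, 0)).sup (fun m => SchwartzMap.seminorm ℝ m.1 m.2) h,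
    by positivity, fun x => ?_⟩
  have h1 := SchwartzMap.one_add_le_sup_seminorm_apply (𝕜 := ℝ) (m := (N, 0)) (k := N) (n := 0)
    le_rfl le_rfl h x
  rw [norm_iteratedFDeriv_zero] at h1
  have hp : (0 : ℝ) < 1 + ‖x‖ := by positivity
  rw [Real.rpow_neg hp.le, ← div_eq_mul_inv, le_div_iff₀ (by positivity), mul_comm]
  refine le_trans ?_ h1
  gcongr
  rw [← Real.rpow_natCast]
  exact Real.rpow_le_rpow_of_exponent_le (by linarith [norm_nonneg x]) hN

/-- Translates of a Schwartz function by vectors of norm at most one are dominated, even after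
multiplication with a polynomial weight, by one integrable function. -/
lemma exists_norm_translate_le {E : Type*} [NormedAddCommGroup E] [NormedSpace ℝ E]
    (hβ : 0 ≤ β) (h : 𝓢(V, E)) : ∃ C, ∀ x z : V, ‖z‖ ≤ 1 →
      polyWeight β x * ‖h (x - z)‖ ≤ C * (1 + ‖x‖) ^ (-(Module.finrank ℝ V + 1 : ℝ)) := by
  set r : ℝ := β + (Module.finrank ℝ V + 1) with hr'
  have hr : 0 ≤ r := by positivity
  obtain ⟨K, hK, hKb⟩ := exists_norm_le_rpow_neg h r
  refine ⟨K * 2 ^ r, fun x z hz => ?_⟩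
  have hp : (0 : ℝ) < 1 + ‖x - z‖ := by positivity
  have hq : (0 : ℝ) < 1 + ‖x‖ := by positivity
  have h3 : 1 + ‖x‖ ≤ 2 * (1 + ‖x - z‖) := by
    have := norm_le_norm_sub_add x z
    linarith [norm_nonneg (x - z)]
  have h4 : (1 + ‖x - z‖) ^ (-r) ≤ 2 ^ r * (1 + ‖x‖) ^ (-r) := by
    rw [Real.rpow_neg hp.le, Real.rpow_neg hq.le, ← div_eq_mul_inv, inv_eq_one_div,
      div_le_div_iff₀ (by positivity) (by positivity), one_mul,
      ← Real.mul_rpow (by norm_num) hp.le]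
    gcongr
  have hpx := polyWeight_nonneg β x
  calc polyWeight β x * ‖h (x - z)‖ ≤ polyWeight β x * (K * (2 ^ r * (1 + ‖x‖) ^ (-r))) := by
        gcongr
        exact (hKb _).trans (by gcongr)
    _ = _ := by
        rw [hr', neg_add, Real.rpow_add hq, polyWeight, Real.rpow_neg hq.le β]
        field_simp

lemma integrable_one_add_norm_finrank :
    Integrable fun x : V => (1 + ‖x‖) ^ (-(Module.finrank ℝ V + 1 : ℝ)) :=
  integrable_one_add_norm (by linarith)

lemma weightedIntegrable_schwartz (hβ : 0 ≤ β) (h : 𝓢(V, ℂ)) : WeightedIntegrable β h := by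
  refine ⟨h.continuous.aestronglyMeasurable, ?_⟩
  obtain ⟨C, hb⟩ := exists_norm_translate_le hβ h
  refine (integrable_one_add_norm_finrank.const_mul C).mono'
    (((continuous_polyWeight β).mul h.continuous.norm).aestronglyMeasurable) <|
    Eventually.of_forall fun x => ?_
  rw [Real.norm_of_nonneg (mul_nonneg (polyWeight_nonneg β x) (norm_nonneg _))]
  simpa using hb x 0 (by simp)

/-! ### The pairing with Fourier transforms of Schwartz functions -/

/-- The function `a ↦ ∫ f(a + x) 𝓕ψ(x) dx`.  Its value at `a` is the value at `ψ` of the Fourier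
transform, in the sense of tempered distributions, of the translate `f(a + ·)`. -/
def pair (f : V → ℂ) (ψ : 𝓢(V, ℂ)) : V → ℂ := corr f (𝓕 ψ : 𝓢(V, ℂ))

lemma pair_apply (f : V → ℂ) (ψ : 𝓢(V, ℂ)) (a : V) : pair f ψ a = ∫ x, f (a + x) * 𝓕 ψ x := rfl

/-- Multiplication of a Schwartz function by `ξ ↦ 2πi⟨ξ, v⟩`, the Fourier counterpart of the
derivative in direction `v`. -/
def coordMul (v : V) (ψ : 𝓢(V, ℂ)) : 𝓢(V, ℂ) :=
  (2 * Real.pi * Complex.I) • SchwartzMap.smulLeftCLM ℂ (fun ξ => inner ℝ ξ v) ψ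

lemma coordMul_apply (v : V) (ψ : 𝓢(V, ℂ)) (ξ : V) :
    coordMul v ψ ξ = 2 * Real.pi * Complex.I * ((inner ℝ ξ v : ℝ) : ℂ) * ψ ξ := by
  have : (fun ξ : V => inner ℝ ξ v).HasTemperateGrowth := ((innerSL ℝ).flip v).hasTemperateGrowth
  simp [coordMul, SchwartzMap.smulLeftCLM_apply_apply this, mul_assoc]

lemma fderiv_fourier_apply (ψ : 𝓢(V, ℂ)) (v x : V) :
    fderiv ℝ (𝓕 ψ : 𝓢(V, ℂ)) x v = -𝓕 (coordMul v ψ) x := by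
  have := congrArg (fun F : 𝓢(V, ℂ) => F x) (SchwartzMap.lineDerivOp_fourier_eq ψ v)
  simp only [SchwartzMap.lineDerivOp_apply_eq_fderiv] at this
  rw [this, coordMul, neg_smul, FourierTransform.fourier_neg]
  simp

/-- `pair f ψ` is differentiable, with directional derivatives again of the form `pair f _`; the
derivatives fall on the Schwartz kernel, since `f` is merely measurable. -/
lemma hasFDerivAt_pair (hβ : 0 ≤ β) (hf : PolyBounded β f) (ψ : 𝓢(V, ℂ)) (a : V) :
    ∃ D : V →L[ℝ] ℂ, HasFDerivAt (pair f ψ) D a ∧ ∀ v, D v = pair f (coordMul v ψ) a := by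
  set h : 𝓢(V, ℂ) := 𝓕 ψ with hh
  have htr : ∀ (g : 𝓢(V, ℂ)) b, (∫ x, f (b + x) * g x) = ∫ x, f x * g (x - b) := fun g b => by
    rw [← integral_sub_right_eq_self _ b]; simp
  obtain ⟨C, hC, hfC⟩ := hf.exists_bound_add hβ
  obtain ⟨K, hKb⟩ := exists_norm_translate_le hβ (SchwartzMap.fderivCLM ℝ V ℂ h)
  have hint : ∀ b, Integrable fun x => f x * h (x - b) := fun b => by
    have := (hf.integrable_mul hβ (weightedIntegrable_schwartz hβ h) b).comp_sub_right b
    simpa using this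
  have hcd : Continuous (fderiv ℝ h) := (SchwartzMap.fderivCLM ℝ V ℂ h).continuous
  set F' : V → V → V →L[ℝ] ℂ := fun b x => f x • (-(fderiv ℝ h (x - b))) with hF'
  set bound : V → ℝ := fun x =>
    C * polyWeight β a * (K * (1 + ‖x - a‖) ^ (-(Module.finrank ℝ V + 1 : ℝ))) with hbound
  have hF'_meas : AEStronglyMeasurable (F' a) :=
    hf.measurable.aestronglyMeasurable.smul (by fun_prop : Continuous _).aestronglyMeasurable
  have hbound_int : Integrable bound :=
    ((integrable_one_add_norm_finrank.comp_sub_right a).const_mul K).const_mul _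
  have hF'_le : ∀ x, ∀ b ∈ Metric.ball a 1, ‖F' b x‖ ≤ bound x := by
    intro x b hb
    have h1 : ‖f x‖ ≤ C * polyWeight β a * polyWeight β (x - a) := by simpa using hfC a (x - a)
    have h2 := hKb (x - a) (b - a) (by simpa [dist_eq_norm] using (Metric.mem_ball.1 hb).le)
    rw [sub_sub_sub_cancel_right] at h2
    have hpa := polyWeight_nonneg β a
    calc ‖F' b x‖ = ‖f x‖ * ‖fderiv ℝ h (x - b)‖ := by rw [hF']; simp [norm_smul]
      _ ≤ (C * polyWeight β a * polyWeight β (x - a)) * ‖fderiv ℝ h (x - b)‖ := by gcongr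
      _ = C * polyWeight β a * (polyWeight β (x - a) * ‖fderiv ℝ h (x - b)‖) := by ring
      _ ≤ bound x := mul_le_mul_of_nonneg_left h2 (by positivity)
  have key := hasFDerivAt_integral_of_dominated_of_fderiv_le (𝕜 := ℝ) (μ := (volume : Measure V))
    (F := fun b x => f x * h (x - b)) (F' := F') (x₀ := a) (bound := bound)
    (Metric.ball_mem_nhds a one_pos) (Eventually.of_forall fun b => (hint b).aestronglyMeasurable)
    (hint a) hF'_meas (Eventually.of_forall hF'_le) hbound_int
    (Eventually.of_forall fun x b _ => by
      have h1 : HasFDerivAt h (fderiv ℝ h (x - b)) (x - b) := h.hasFDerivAt _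
      have h2 := (h1.comp b ((hasFDerivAt_id b).const_sub x)).const_mul (f x)
      refine h2.congr_fderiv ?_
      ext v
      simp [hF'])
  have hF'_int : Integrable (F' a) := hbound_int.mono' hF'_meas <|
    Eventually.of_forall fun x => hF'_le x a (Metric.mem_ball_self one_pos)
  refine ⟨∫ x, F' a x, ?_, fun v => ?_⟩
  · have : pair f ψ = fun b => ∫ x, f x * h (x - b) := funext fun b => htr h b
    rw [this]
    exact key
  · rw [ContinuousLinearMap.integral_apply hF'_int, pair_apply, htr]
    congr 1
    ext x
    have := fderiv_fourier_apply ψ v (x - a)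
    simp [hF', hh, this]

lemma continuous_pair (hβ : 0 ≤ β) (hf : PolyBounded β f) (ψ : 𝓢(V, ℂ)) : Continuous (pair f ψ) :=
  continuous_iff_continuousAt.2 fun a =>
    let ⟨_, hD, _⟩ := hasFDerivAt_pair hβ hf ψ a
    hD.continuousAt

lemma polyBounded_pair (hβ : 0 ≤ β) (hf : PolyBounded β f) (ψ : 𝓢(V, ℂ)) :
    PolyBounded β (pair f ψ) := by
  refine ⟨(continuous_pair hβ hf ψ).measurable, ?_⟩
  obtain ⟨C, hC, hfC⟩ := hf.exists_bound_add hβ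
  set h : 𝓢(V, ℂ) := 𝓕 ψ
  refine ⟨C * ∫ x, polyWeight β x * ‖h x‖, mul_nonneg hC (integral_nonneg fun x =>
    mul_nonneg (polyWeight_nonneg β x) (norm_nonneg _)), fun a => ?_⟩
  have := norm_corr_le (weightedIntegrable_schwartz hβ h) (hfC a)
  rwa [mul_right_comm] at this

lemma pair_sub (hβ : 0 ≤ β) (hf : PolyBounded β f) (φ ψ : 𝓢(V, ℂ)) (a : V) :
    pair f (φ - ψ) a = pair f φ a - pair f ψ a := by
  have : 𝓕 (φ - ψ) = 𝓕 φ - 𝓕 ψ := map_sub (FourierTransform.fourierCLM ℂ 𝓢(V, ℂ)) φ ψ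
  simp only [pair_apply, this]
  rw [← integral_sub (hf.integrable_mul hβ (weightedIntegrable_schwartz hβ (𝓕 φ)) a)
    (hf.integrable_mul hβ (weightedIntegrable_schwartz hβ (𝓕 ψ)) a)]
  simp [mul_sub]

lemma pair_sum {ι : Type*} (hβ : 0 ≤ β) (hf : PolyBounded β f) (s : Finset ι)
    (ψ : ι → 𝓢(V, ℂ)) (a : V) : pair f (∑ i ∈ s, ψ i) a = ∑ i ∈ s, pair f (ψ i) a := by
  simp only [pair_apply]
  rw [← integral_finsetSum s fun i _ =>
    hf.integrable_mul hβ (weightedIntegrable_schwartz hβ (𝓕 (ψ i))) a]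
  simp only [← Finset.mul_sum]
  congr 1
  ext x
  have : 𝓕 (∑ i ∈ s, ψ i) = ∑ i ∈ s, 𝓕 (ψ i) :=
    map_sum (FourierTransform.fourierCLM ℂ 𝓢(V, ℂ)) ψ s
  rw [this, sum_apply]

/-! ### Cutoffs, products and dilations on the Fourier side -/

/-- A real test function as a complex valued Schwartz function. -/
def ofRealSchwartz {γ : V → ℝ} (hγ : ContDiff ℝ ∞ γ) (hγc : HasCompactSupport γ) : 𝓢(V, ℂ) :=
  HasCompactSupport.toSchwartzMap (f := fun ξ => (γ ξ : ℂ))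
    (hγc.comp_left Complex.ofReal_zero) (Complex.ofRealCLM.contDiff.comp hγ)

lemma ofRealSchwartz_apply {γ : V → ℝ} (hγ : ContDiff ℝ ∞ γ) (hγc : HasCompactSupport γ) (ξ : V) :
    ofRealSchwartz hγ hγc ξ = γ ξ := rfl

lemma exists_fourier_eq_ofReal {γ : V → ℝ} (hγ : ContDiff ℝ ∞ γ) (hγc : HasCompactSupport γ) :
    ∃ θ : 𝓢(V, ℂ), ∀ x, 𝓕 θ x = γ x := by
  refine ⟨𝓕⁻ (ofRealSchwartz hγ hγc), fun x => ?_⟩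
  rw [FourierTransform.fourier_fourierInv_eq, ofRealSchwartz_apply]

variable (V) in
lemma exists_schwartz_cutoff : ∃ κ : 𝓢(V, ℂ), HasCompactSupport κ ∧
    ∃ ρ > 0, ∀ ξ, ‖ξ‖ < ρ → κ ξ = 1 := by
  obtain ⟨b⟩ : Nonempty (ContDiffBump (0 : V)) := inferInstance
  refine ⟨ofRealSchwartz b.contDiff b.hasCompactSupport,
    b.hasCompactSupport.comp_left Complex.ofReal_zero, b.rIn, b.rIn_pos, fun ξ hξ => ?_⟩
  rw [ofRealSchwartz_apply, b.one_of_mem_closedBall (by simpa using hξ.le), Complex.ofReal_one]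

lemma exists_schwartz_mul (κ θ : 𝓢(V, ℂ)) : ∃ χ : 𝓢(V, ℂ), ∀ ξ, χ ξ = κ ξ * θ ξ :=
  ⟨SchwartzMap.pairing (ContinuousLinearMap.mul ℂ ℂ) κ θ, fun ξ => by simp⟩

lemma fourier_mul_apply {κ θ χ : 𝓢(V, ℂ)} (h : ∀ ξ, χ ξ = κ ξ * θ ξ) (x : V) :
    𝓕 χ x = ∫ y, 𝓕 θ y * 𝓕 κ (x - y) := by
  have hneg : ∀ (ψ : 𝓢(V, ℂ)) y, 𝓕 ψ y = 𝓕⁻ ψ (-y) := fun ψ y => by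
    rw [SchwartzMap.fourierInv_coe, SchwartzMap.fourier_coe, Real.fourierInv_eq_fourier_neg,
      neg_neg]
  have h1 : 𝓕⁻ χ = SchwartzMap.convolution (ContinuousLinearMap.mul ℂ ℂ) (𝓕⁻ θ) (𝓕⁻ κ) := by
    have : 𝓕 (SchwartzMap.convolution (ContinuousLinearMap.mul ℂ ℂ) (𝓕⁻ θ) (𝓕⁻ κ)) = χ := by
      rw [SchwartzMap.fourier_convolution]
      ext ξ
      simp [h, mul_comm]
    rw [← this]
    simp
  rw [hneg, h1, SchwartzMap.convolution_apply, convolution_def, ← integral_neg_eq_self]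
  congr 1
  ext y
  rw [ContinuousLinearMap.mul_apply', hneg θ, hneg κ]
  congr 2
  abel

/-- Multiplication on the Fourier side is correlation: pairing with the product `κ θ` amounts to
pairing with `κ` and correlating the result with `𝓕θ`. -/
lemma pair_mul (hβ : 0 ≤ β) (hf : PolyBounded β f) {κ θ χ : 𝓢(V, ℂ)}
    (h : ∀ ξ, χ ξ = κ ξ * θ ξ) (a : V) : pair f χ a = corr (pair f κ) (𝓕 θ : 𝓢(V, ℂ)) a := by
  have hθ := (weightedIntegrable_schwartz hβ (𝓕 θ)).integrable_mul
  have hκ := (weightedIntegrable_schwartz hβ (𝓕 κ)).integrable_mul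
  obtain ⟨C, hC, hfC⟩ := hf.exists_bound_add hβ
  have hint : Integrable (fun p : V × V => f (a + p.1) * (𝓕 θ p.2 * 𝓕 κ (p.1 - p.2))) := by
    have h1 := (hθ.convolution_integrand (ContinuousLinearMap.mul ℝ ℝ) hκ).const_mul
      (C * polyWeight β a)
    refine h1.mono' ?_ (Eventually.of_forall fun p => ?_)
    · refine (Measurable.aestronglyMeasurable ?_).mul (Continuous.aestronglyMeasurable ?_)
      · exact hf.measurable.comp (measurable_fst.const_add a)
      · exact ((𝓕 θ : 𝓢(V, ℂ)).continuous.comp continuous_snd).mul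
          ((𝓕 κ : 𝓢(V, ℂ)).continuous.comp (continuous_fst.sub continuous_snd))
    · have h2 : polyWeight β p.1 ≤ polyWeight β p.2 * polyWeight β (p.1 - p.2) := by
        simpa using polyWeight_add_le hβ p.2 (p.1 - p.2)
      have hpa := polyWeight_nonneg β a
      rw [norm_mul, norm_mul, ContinuousLinearMap.mul_apply']
      calc ‖f (a + p.1)‖ * (‖𝓕 θ p.2‖ * ‖𝓕 κ (p.1 - p.2)‖)
          ≤ (C * polyWeight β a * (polyWeight β p.2 * polyWeight β (p.1 - p.2)))
            * (‖𝓕 θ p.2‖ * ‖𝓕 κ (p.1 - p.2)‖) := by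
              gcongr
              exact (hfC a p.1).trans (by gcongr)
        _ = _ := by ring
  have hswap := integral_integral_swap (μ := (volume : Measure V)) (ν := (volume : Measure V))
    (f := fun x y => f (a + x) * (𝓕 θ y * 𝓕 κ (x - y))) hint
  simp_rw [integral_const_mul] at hswap
  simp_rw [pair_apply, fourier_mul_apply h]
  rw [hswap, corr]
  congr 1
  ext y
  rw [← integral_add_right_eq_self _ y, pair_apply, ← integral_mul_const]
  congr 1
  ext x
  rw [add_sub_cancel_right, ← add_assoc, add_right_comm]
  ring

lemma exists_schwartz_dilate (κ : 𝓢(V, ℂ)) {ε : ℝ} (hε : ε ≠ 0) (ξ₀ : V) :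
    ∃ χ : 𝓢(V, ℂ), ∀ ξ, χ ξ = κ (ε⁻¹ • (ξ - ξ₀)) := by
  refine ⟨SchwartzMap.compSubConstCLM ℂ ξ₀ (SchwartzMap.compCLMOfContinuousLinearEquiv ℂ
    (ContinuousLinearEquiv.smulLeft (Units.mk0 ε⁻¹ (inv_ne_zero hε)) : V ≃L[ℝ] V) κ), fun ξ => ?_⟩
  rw [SchwartzMap.compSubConstCLM_apply, SchwartzMap.compCLMOfContinuousLinearEquiv_apply]
  rfl

lemma fourier_dilate_apply {κ χ : 𝓢(V, ℂ)} {ε : ℝ} (hε : 0 < ε) {ξ₀ : V}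
    (h : ∀ ξ, χ ξ = κ (ε⁻¹ • (ξ - ξ₀))) (x : V) :
    𝓕 χ x = (ε ^ Module.finrank ℝ V : ℝ) *
      (Complex.exp (((-2 * Real.pi * inner ℝ ξ₀ x : ℝ) : ℂ) * Complex.I) * 𝓕 κ (ε • x)) := by
  rw [SchwartzMap.fourier_coe, SchwartzMap.fourier_coe, Real.fourier_eq', Real.fourier_eq']
  have h1 := Measure.integral_comp_inv_smul_of_nonneg (volume : Measure V)
    (fun ξ => Complex.exp (((-2 * Real.pi * inner ℝ ξ (ε • x) : ℝ) : ℂ) * Complex.I) • κ ξ) hε.le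
  rw [Complex.real_smul] at h1
  rw [mul_left_comm, ← h1, ← integral_const_mul,
    ← integral_add_right_eq_self _ ξ₀]
  congr 1
  ext ξ
  rw [h, add_sub_cancel_right, smul_eq_mul, smul_eq_mul, ← mul_assoc, ← Complex.exp_add]
  congr 2
  rw [real_inner_smul_left, real_inner_smul_right, inner_add_left,
    ← mul_assoc ε⁻¹, inv_mul_cancel₀ hε.ne', one_mul]
  push_cast
  ring

/-! ### The weighted modulus of continuity of a Schwartz function -/

/-- The weighted `L¹` distance between `k` and its translate by `z`. -/
def translationDefect (β : ℝ) (k : V → ℂ) (z : V) : ℝ :=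
  ∫ x, polyWeight β x * ‖k x - k (x - z)‖

lemma WeightedIntegrable.comp_sub (hβ : 0 ≤ β) (hk : WeightedIntegrable β k) (z : V) :
    WeightedIntegrable β fun x => k (x - z) := by
  have hm : AEStronglyMeasurable fun x => k (x - z) :=
    hk.aestronglyMeasurable.comp_measurePreserving (measurePreserving_sub_right volume z)
  refine ⟨hm, ?_⟩
  refine ((hk.integrable_mul.comp_sub_right z).const_mul (polyWeight β z)).mono'
    ((continuous_polyWeight β).aestronglyMeasurable.mul hm.norm) <| Eventually.of_forall fun x => ?_
  rw [Real.norm_of_nonneg (mul_nonneg (polyWeight_nonneg β x) (norm_nonneg _)), ← mul_assoc]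
  gcongr
  simpa using polyWeight_add_le hβ z (x - z)

lemma WeightedIntegrable.sub {l : V → ℂ} (hk : WeightedIntegrable β k)
    (hl : WeightedIntegrable β l) : WeightedIntegrable β fun x => k x - l x := by
  refine ⟨hk.aestronglyMeasurable.sub hl.aestronglyMeasurable, ?_⟩
  refine (hk.integrable_mul.add hl.integrable_mul).mono'
    ((continuous_polyWeight β).aestronglyMeasurable.mul
      (hk.aestronglyMeasurable.sub hl.aestronglyMeasurable).norm) <|
    Eventually.of_forall fun x => ?_
  have := polyWeight_nonneg β x
  rw [Real.norm_of_nonneg (by positivity), Pi.add_apply, ← mul_add]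
  gcongr
  exact norm_sub_le _ _

lemma translationDefect_nonneg (k : V → ℂ) (z : V) : 0 ≤ translationDefect β k z :=
  integral_nonneg fun x => mul_nonneg (polyWeight_nonneg β x) (norm_nonneg _)

lemma exists_translationDefect_le (hβ : 0 ≤ β) (hk : WeightedIntegrable β k) :
    ∃ A, ∀ z, translationDefect β k z ≤ A * polyWeight β z := by
  set A := ∫ x, polyWeight β x * ‖k x‖ with hA
  have hA0 : 0 ≤ A := integral_nonneg fun x => mul_nonneg (polyWeight_nonneg β x) (norm_nonneg _)
  refine ⟨2 * A, fun z => ?_⟩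
  have h1 : ∫ x, polyWeight β x * ‖k (x - z)‖ ≤ polyWeight β z * A := by
    rw [hA, ← integral_sub_right_eq_self (fun x => polyWeight β x * ‖k x‖) z, ← integral_const_mul]
    refine integral_mono (hk.comp_sub hβ z).integrable_mul
      ((hk.integrable_mul.comp_sub_right z).const_mul _) fun x => ?_
    simp only [← mul_assoc]
    gcongr
    simpa using polyWeight_add_le hβ z (x - z)
  have h2 : translationDefect β k z ≤ A + ∫ x, polyWeight β x * ‖k (x - z)‖ := by
    rw [translationDefect, hA, ← integral_add hk.integrable_mul (hk.comp_sub hβ z).integrable_mul]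
    refine integral_mono (hk.sub (hk.comp_sub hβ z)).integrable_mul
      (hk.integrable_mul.add (hk.comp_sub hβ z).integrable_mul) fun x => ?_
    have := polyWeight_nonneg β x
    simp only [← mul_add]
    gcongr
    exact norm_sub_le _ _
  nlinarith [one_le_polyWeight hβ z]

lemma tendsto_translationDefect (hβ : 0 ≤ β) (h : 𝓢(V, ℂ)) :
    Tendsto (translationDefect β h) (𝓝 0) (𝓝 0) := by
  obtain ⟨C, hC⟩ := exists_norm_translate_le hβ h
  have hlim : (0 : ℝ) = ∫ x, polyWeight β x * ‖h x - h (x - 0)‖ := by simp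
  rw [hlim]
  refine tendsto_integral_filter_of_dominated_convergence
    (fun x => 2 * (C * (1 + ‖x‖) ^ (-(Module.finrank ℝ V + 1 : ℝ)))) ?_ ?_
    ((integrable_one_add_norm_finrank.const_mul C).const_mul 2) ?_
  · refine Eventually.of_forall fun z => Continuous.aestronglyMeasurable ?_
    have := continuous_polyWeight (E := V) β
    fun_prop
  · filter_upwards [Metric.ball_mem_nhds (0 : V) one_pos] with z hz
    refine Eventually.of_forall fun x => ?_
    have hz' : ‖z‖ ≤ 1 := by simpa using (Metric.mem_ball.1 hz).le
    have h1 := hC x z hz'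
    have h2 := hC x 0 (by simp)
    rw [sub_zero] at h2
    have := polyWeight_nonneg β x
    rw [Real.norm_of_nonneg (by positivity)]
    calc polyWeight β x * ‖h x - h (x - z)‖ ≤ polyWeight β x * (‖h x‖ + ‖h (x - z)‖) := by
          gcongr
          exact norm_sub_le _ _
      _ ≤ _ := by linarith
  · refine Eventually.of_forall fun x => ?_
    refine Continuous.tendsto' ?_ _ _ rfl
    fun_prop

lemma measurable_translationDefect (h : 𝓢(V, ℂ)) : Measurable (translationDefect β h) := by
  have hc : Continuous fun p : V × V => polyWeight β p.2 * ‖h p.2 - h (p.2 - p.1)‖ := by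
    have := continuous_polyWeight (E := V) β
    fun_prop
  exact hc.stronglyMeasurable.integral_prod_right'.measurable

/-- Averaging the translation defect at scale `ε` against an element of `L¹_β` gives a quantity that
vanishes as `ε → 0`.  This replaces the continuity of translations in Wiener's local inversion. -/
lemma tendsto_integral_translationDefect (hβ : 0 ≤ β) {g : V → ℂ} (hg : WeightedIntegrable β g)
    (h : 𝓢(V, ℂ)) :
    Tendsto (fun ε : ℝ => ∫ y, ‖g y‖ * translationDefect β h (ε • y)) (𝓝[>] 0) (𝓝 0) := by
  obtain ⟨A, hA⟩ := exists_translationDefect_le hβ (weightedIntegrable_schwartz hβ h)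
  have hA0 : 0 ≤ A := by
    simpa using (translationDefect_nonneg (β := β) h (0 : V)).trans (hA 0)
  suffices h : Tendsto (fun ε : ℝ => ∫ y, ‖g y‖ * translationDefect β h (ε • y)) (𝓝[>] 0)
      (𝓝 (∫ y : V, ‖g y‖ * 0)) by simpa using h
  refine tendsto_integral_filter_of_dominated_convergence
    (fun y => A * (polyWeight β y * ‖g y‖)) ?_ ?_ (hg.integrable_mul.const_mul A) ?_
  · exact Eventually.of_forall fun ε => hg.aestronglyMeasurable.norm.mul
      ((measurable_translationDefect h).comp (measurable_const_smul ε)).aestronglyMeasurable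
  · filter_upwards [Ioc_mem_nhdsGT (zero_lt_one' ℝ)] with ε hε
    refine Eventually.of_forall fun y => ?_
    rw [Real.norm_of_nonneg (mul_nonneg (norm_nonneg _) (translationDefect_nonneg _ _))]
    calc ‖g y‖ * translationDefect β h (ε • y) ≤ ‖g y‖ * (A * polyWeight β y) := by
          gcongr
          exact (hA _).trans (by
            gcongr
            exact polyWeight_smul_le_polyWeight hβ hε.1.le hε.2 y)
      _ = _ := by ring
  · refine Eventually.of_forall fun y => ?_
    refine ((tendsto_translationDefect hβ h).comp ?_).const_mul _
    exact ((continuous_id.smul continuous_const).tendsto' (0 : ℝ) _ (zero_smul ℝ y)).mono_left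
      nhdsWithin_le_nhds

/-! ### The local Wiener lemma -/

/-- The quantitative core of the local Wiener lemma.  If `F` is reproduced by a kernel with
frequencies within a distance of order `ε` of `ξ₀` and is annihilated by `g`, then a bound of `F` by
`M (1 + ε|a|)^β` improves by the ratio of an averaged translation defect, which is small with `ε`,
to the Fourier coefficient of `g` at `-ξ₀`. -/
lemma norm_mul_le_of_reproducing (hβ : 0 ≤ β) {F g : V → ℂ} (hF : Measurable F)
    (hg : WeightedIntegrable β g) (hgF : ∀ a, corr F g a = 0) {κ χ : 𝓢(V, ℂ)} {ε : ℝ}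
    (hε : 0 < ε) (hε1 : ε ≤ 1) {ξ₀ : V} (hχ : ∀ ξ, χ ξ = κ (ε⁻¹ • (ξ - ξ₀)))
    (hFχ : ∀ a, corr F (𝓕 χ : 𝓢(V, ℂ)) a = F a) {M : ℝ} (hM : 0 ≤ M)
    (hFM : ∀ a, ‖F a‖ ≤ M * polyWeight β (ε • a)) (a : V) :
    ‖∫ y, Complex.exp (((2 * Real.pi * inner ℝ ξ₀ y : ℝ) : ℂ) * Complex.I) * g y‖ * ‖F a‖ ≤
      M * polyWeight β (ε • a) *
        ∫ y, ‖g y‖ * translationDefect β (𝓕 κ : 𝓢(V, ℂ)) (ε • y) := by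
  set k : 𝓢(V, ℂ) := 𝓕 κ with hk
  set d := Module.finrank ℝ V
  set e : V → ℂ := fun y => Complex.exp (((2 * Real.pi * inner ℝ ξ₀ y : ℝ) : ℂ) * Complex.I) with he
  have he1 : ∀ y, ‖e y‖ = 1 := fun y => Complex.norm_exp_ofReal_mul_I _
  have hec : Continuous e := by fun_prop
  have hv : ∀ x, 𝓕 χ x = (ε ^ d : ℝ) * (e (-x) * k (ε • x)) := fun x => by
    rw [fourier_dilate_apply hε hχ]
    simp [he, d, hk]
  have hFM' : ∀ a x, ‖F (a + x)‖ ≤ M * polyWeight β (ε • a) * polyWeight β x := fun a x => by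
    refine (hFM _).trans ?_
    rw [mul_assoc, smul_add]
    gcongr
    exact (polyWeight_add_le hβ _ _).trans (by
      gcongr
      · exact polyWeight_nonneg β _
      · exact polyWeight_smul_le_polyWeight hβ hε.le hε1 x)
  have hFint : ∀ a (l : V → ℂ), WeightedIntegrable β l → Integrable fun x => F (a + x) * l x :=
    fun a l hl => integrable_mul_of_norm_le (hF.comp (measurable_const_add a)) (hFM' a) hl
  have hχw := weightedIntegrable_schwartz hβ (𝓕 χ)
  have hgi := hg.integrable hβ
  have hei : Integrable fun y => e y * g y :=
    hgi.bdd_mul hec.aestronglyMeasurable (Eventually.of_forall fun y => (he1 y).le)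
  -- The difference of the two reproducing formulas is an integral of translation defects.
  have hdiff : ∀ y, ‖e y * F a - F (a + y)‖ ≤
      M * polyWeight β (ε • a) * translationDefect β k (ε • y) := by
    intro y
    have h1 : F (a + y) = ∫ x, F (a + x) * 𝓕 χ (x - y) := by
      rw [← hFχ (a + y), corr, ← integral_sub_right_eq_self _ y]
      congr 1
      ext x
      congr 2
      abel
    have h2 : e y * F a - F (a + y) = ∫ x, F (a + x) * (e y * 𝓕 χ x - 𝓕 χ (x - y)) := by
      rw [h1, ← hFχ a, corr, ← integral_const_mul,
        ← integral_sub ((hFint a _ hχw).const_mul _) (hFint a _ (hχw.comp_sub hβ y))]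
      congr 1
      ext x
      ring
    have h3 : ∀ x, e y * 𝓕 χ x - 𝓕 χ (x - y) =
        (ε ^ d : ℝ) * (e (y - x) * (k (ε • x) - k (ε • x - ε • y))) := by
      intro x
      have hexp : e y * e (-x) = e (y - x) := by
        simp only [he, ← Complex.exp_add]
        congr 1
        simp only [sub_eq_add_neg, inner_add_right]
        push_cast
        ring
      rw [hv, hv, neg_sub, ← smul_sub, ← hexp]
      ring
    have hdef : ε ^ d * ∫ x, polyWeight β (ε • x) * ‖k (ε • x) - k (ε • x - ε • y)‖ =
        translationDefect β k (ε • y) := by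
      rw [translationDefect, Measure.integral_comp_smul_of_nonneg volume
        (fun x => polyWeight β x * ‖k x - k (x - ε • y)‖) ε (hR := hε.le), smul_eq_mul,
        mul_inv_cancel_left₀ (by positivity)]
    have hint : Integrable fun x => polyWeight β (ε • x) * ‖k (ε • x) - k (ε • x - ε • y)‖ := by
      have hw := weightedIntegrable_schwartz hβ k
      exact (hw.sub (hw.comp_sub hβ (ε • y))).integrable_mul.comp_smul hε.ne'
    rw [h2, ← hdef, ← mul_assoc, ← integral_const_mul]
    refine norm_integral_le_of_norm_le (hint.const_mul _) (Eventually.of_forall fun x => ?_)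
    have h4 : ‖F (a + x)‖ ≤ M * (polyWeight β (ε • a) * polyWeight β (ε • x)) := by
      refine (hFM _).trans ?_
      rw [smul_add]
      gcongr
      exact polyWeight_add_le hβ _ _
    rw [h3, norm_mul, norm_mul, norm_mul, he1, one_mul, Complex.norm_real,
      Real.norm_of_nonneg (by positivity)]
    calc _ ≤ M * (polyWeight β (ε • a) * polyWeight β (ε • x)) *
          (ε ^ d * ‖k (ε • x) - k (ε • x - ε • y)‖) := by gcongr
      _ = _ := by ring
  have hzero : ∫ y, F (a + y) * g y = 0 := hgF a
  have hmain : (∫ y, e y * g y) * F a = ∫ y, (e y * F a - F (a + y)) * g y := by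
    have : ∀ y, (e y * F a - F (a + y)) * g y = (e y * g y) * F a - F (a + y) * g y :=
      fun y => by ring
    simp_rw [this]
    rw [integral_sub (hei.mul_const _) (hFint a g hg), hzero, sub_zero, integral_mul_const]
  rw [← norm_mul, hmain, ← integral_const_mul]
  obtain ⟨A, hA⟩ := exists_translationDefect_le hβ (weightedIntegrable_schwartz hβ k)
  have hA0 : 0 ≤ A := by
    simpa using (translationDefect_nonneg (β := β) k (0 : V)).trans (hA 0)
  have hbint : Integrable fun y => ‖g y‖ * translationDefect β k (ε • y) := by
    refine (hg.integrable_mul.const_mul A).mono' (hg.aestronglyMeasurable.norm.mul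
      ((measurable_translationDefect k).comp (measurable_const_smul ε)).aestronglyMeasurable)
      (Eventually.of_forall fun y => ?_)
    rw [Real.norm_of_nonneg (mul_nonneg (norm_nonneg _) (translationDefect_nonneg _ _))]
    calc ‖g y‖ * translationDefect β k (ε • y) ≤ ‖g y‖ * (A * polyWeight β y) := by
          gcongr
          exact (hA _).trans (by
            gcongr
            exact polyWeight_smul_le_polyWeight hβ hε.le hε1 y)
      _ = _ := by ring
  refine norm_integral_le_of_norm_le (hbint.const_mul _) (Eventually.of_forall fun y => ?_)
  rw [norm_mul]
  calc _ ≤ M * polyWeight β (ε • a) * translationDefect β k (ε • y) * ‖g y‖ := by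
        gcongr
        exact hdiff y
    _ = _ := by ring

lemma corr_pair_eq_zero (hβ : 0 ≤ β) (hf : PolyBounded β f) {g : V → ℂ}
    (hg : WeightedIntegrable β g) (hfg : ∀ a, corr f g a = 0) (ψ : 𝓢(V, ℂ)) (a : V) :
    corr (pair f ψ) g a = 0 := by
  have hψ := (weightedIntegrable_schwartz hβ (𝓕 ψ))
  obtain ⟨C, hC, hfC⟩ := hf.exists_bound_add hβ
  have hint : Integrable (fun p : V × V => f (a + p.1 + p.2) * (𝓕 ψ p.2 * g p.1)) := by
    refine ((hg.integrable_mul.mul_prod hψ.integrable_mul).const_mul (C * polyWeight β a)).mono'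
      ?_ (Eventually.of_forall fun p => ?_)
    · refine (Measurable.aestronglyMeasurable ?_).mul
        (((𝓕 ψ : 𝓢(V, ℂ)).continuous.comp continuous_snd).aestronglyMeasurable.mul
          hg.aestronglyMeasurable.comp_fst)
      exact hf.measurable.comp ((measurable_fst.const_add a).add measurable_snd)
    · have hpa := polyWeight_nonneg β a
      rw [norm_mul, norm_mul, add_assoc]
      calc _ ≤ (C * polyWeight β a * (polyWeight β p.1 * polyWeight β p.2)) *
            (‖𝓕 ψ p.2‖ * ‖g p.1‖) := by
              gcongr
              exact (hfC a _).trans (by gcongr; exact polyWeight_add_le hβ _ _)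
        _ = _ := by ring
  have hswap := integral_integral_swap (μ := (volume : Measure V)) (ν := (volume : Measure V))
    (f := fun y x => f (a + y + x) * (𝓕 ψ x * g y)) hint
  have h1 : ∀ y, ∫ x, f (a + y + x) * (𝓕 ψ x * g y) = pair f ψ (a + y) * g y := fun y => by
    rw [pair_apply, ← integral_mul_const]
    simp_rw [mul_assoc]
  have h2 : ∀ x, ∫ y, f (a + y + x) * (𝓕 ψ x * g y) = 0 := fun x => by
    have := hfg (a + x)
    rw [corr] at this
    calc _ = 𝓕 ψ x * ∫ y, f (a + x + y) * g y := by
          rw [← integral_const_mul]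
          congr 1
          ext y
          rw [add_right_comm]
          ring
      _ = 0 := by rw [this, mul_zero]
  simp_rw [h1, h2] at hswap
  rw [corr, hswap, integral_zero]

/-- Local form of Wiener's theorem: if `f` annihilates all translates of `g ∈ L¹_β` and the Fourier
transform of `g` does not vanish at `-ξ₀`, then `𝓕f` vanishes near `ξ₀`. -/
theorem exists_pair_eq_zero_of_support_subset (hβ : 0 ≤ β) (hf : PolyBounded β f) {g : V → ℂ}
    (hg : WeightedIntegrable β g) (hfg : ∀ a, corr f g a = 0) {ξ₀ : V}
    (hξ₀ : ∫ y, Complex.exp (((2 * Real.pi * inner ℝ ξ₀ y : ℝ) : ℂ) * Complex.I) * g y ≠ 0) :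
    ∃ r > 0, ∀ ψ : 𝓢(V, ℂ), Function.support ψ ⊆ Metric.ball ξ₀ r → pair f ψ = 0 := by
  set c := ∫ y, Complex.exp (((2 * Real.pi * inner ℝ ξ₀ y : ℝ) : ℂ) * Complex.I) * g y
  obtain ⟨κ, -, ρ, hρ, hκ⟩ := exists_schwartz_cutoff V
  have hc : 0 < ‖c‖ := norm_pos_iff.2 hξ₀
  obtain ⟨ε, hq, hε, hε1⟩ := (((tendsto_integral_translationDefect hβ hg (𝓕 κ)).eventually
    (gt_mem_nhds hc)).and (Ioc_mem_nhdsGT (zero_lt_one' ℝ))).exists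
  set q := ∫ y, ‖g y‖ * translationDefect β (𝓕 κ : 𝓢(V, ℂ)) (ε • y) with hqdef
  obtain ⟨χ, hχ⟩ := exists_schwartz_dilate κ hε.ne' ξ₀
  refine ⟨ε * ρ, mul_pos hε hρ, fun ψ hψ => ?_⟩
  have hprod : ∀ ξ, ψ ξ = ψ ξ * χ ξ := fun ξ => by
    by_cases h : ψ ξ = 0
    · simp [h]
    · have hξ : ‖ξ - ξ₀‖ < ε * ρ := by simpa [dist_eq_norm] using hψ h
      rw [hχ, hκ, mul_one]
      rw [norm_smul, norm_inv, Real.norm_of_nonneg hε.le, inv_mul_lt_iff₀ hε]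
      exact hξ
  set F := pair f ψ with hF
  have hFp := polyBounded_pair hβ hf ψ
  obtain ⟨C, hC, hFC⟩ := hFp.exists_bound
  have hw : ∀ a : V, 0 < polyWeight β (ε • a) := fun a => polyWeight_pos β _
  -- `M` is the best constant in `|F(a)| ≤ M (1 + ε|a|)^β`; the estimate improves it by `q / |c|`.
  set M := ⨆ a, ‖F a‖ / polyWeight β (ε • a) with hM
  have hbdd : BddAbove (Set.range fun a => ‖F a‖ / polyWeight β (ε • a)) := by
    refine ⟨C * ε⁻¹ ^ β, ?_⟩
    rintro _ ⟨a, rfl⟩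
    rw [div_le_iff₀ (hw a), mul_assoc]
    refine (hFC a).trans ?_
    gcongr
    simpa [hε.ne'] using polyWeight_smul_le hβ ((one_le_inv₀ hε).2 hε1) (ε • a)
  have hFM : ∀ a, ‖F a‖ ≤ M * polyWeight β (ε • a) := fun a => by
    rw [← div_le_iff₀ (hw a)]
    exact le_ciSup hbdd a
  have hM0 : 0 ≤ M := Real.iSup_nonneg fun a => by have := hw a; positivity
  have hle : M ≤ M * q / ‖c‖ := by
    refine ciSup_le fun a => ?_
    have := norm_mul_le_of_reproducing hβ hFp.measurable hg (corr_pair_eq_zero hβ hf hg hfg ψ) hε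
      hε1 hχ (fun a => (pair_mul hβ hf hprod a).symm) hM0 hFM a
    rw [div_le_div_iff₀ (hw a) hc]
    linarith
  have hM_zero : M = 0 := by
    rw [le_div_iff₀ hc] at hle
    nlinarith
  ext a
  have := hFM a
  rw [hM_zero, zero_mul] at this
  simpa using this

/-! ### Localization of the Fourier transform at the origin -/

/-- The Fourier transform of `f` is supported at the origin: it annihilates the test functions that
are supported away from the origin.  The condition is imposed on all translates of `f`, to which it
passes automatically, since this is the form in which it is proved and used. -/
def FourierSupportedAtZero (f : V → ℂ) : Prop :=
  ∀ ψ : 𝓢(V, ℂ), HasCompactSupport ψ → 0 ∉ tsupport ψ → pair f ψ = 0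

open scoped Manifold in
/-- A smooth partition of unity turns vanishing near every nonzero point into vanishing away from
the origin. -/
lemma fourierSupportedAtZero_of_local (hβ : 0 ≤ β) (hf : PolyBounded β f)
    (hloc : ∀ ξ₀ : V, ξ₀ ≠ 0 → ∃ r > 0, ∀ ψ : 𝓢(V, ℂ),
      Function.support ψ ⊆ Metric.ball ξ₀ r → pair f ψ = 0) : FourierSupportedAtZero f := by
  intro ψ hψ h0
  have hloc' : ∀ ξ₀ : V, ∃ r > 0, ξ₀ ≠ 0 → ∀ ψ : 𝓢(V, ℂ),
      Function.support ψ ⊆ Metric.ball ξ₀ r → pair f ψ = 0 := fun ξ₀ => by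
    by_cases h : ξ₀ = 0
    · exact ⟨1, one_pos, fun h' => absurd h h'⟩
    · obtain ⟨r, hr, hr'⟩ := hloc ξ₀ h
      exact ⟨r, hr, fun _ => hr'⟩
  choose r hr hrv using hloc'
  obtain ⟨t, ht, hcover⟩ := hψ.isCompact.elim_nhds_subcover (fun ξ => Metric.ball ξ (r ξ))
    fun ξ _ => Metric.ball_mem_nhds ξ (hr ξ)
  obtain ⟨ρ, hρ⟩ := SmoothPartitionOfUnity.exists_isSubordinate 𝓘(ℝ, V) (isClosed_tsupport ψ)
    (fun ξ : t => Metric.ball (ξ : V) (r ξ)) (fun _ => Metric.isOpen_ball)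
    (hcover.trans (by simp [Set.iUnion_subtype]))
  let ψi : t → 𝓢(V, ℂ) := fun i => HasCompactSupport.toSchwartzMap
    (f := fun ξ => ((ρ i ξ : ℝ) : ℂ) * ψ ξ) hψ.mul_left
    ((Complex.ofRealCLM.contDiff.comp (ρ i).contMDiff.contDiff).mul (ψ.smooth ⊤))
  have hψi : ∀ i ξ, ψi i ξ = ((ρ i ξ : ℝ) : ℂ) * ψ ξ := fun _ _ => rfl
  have hsum : ψ = ∑ i, ψi i := by
    ext ξ
    rw [sum_apply]
    simp_rw [hψi]
    rw [← Finset.sum_mul, ← Complex.ofReal_sum]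
    by_cases hξ : ξ ∈ tsupport ψ
    · have := ρ.sum_eq_one hξ
      rw [finsum_eq_sum_of_fintype] at this
      rw [this, Complex.ofReal_one, one_mul]
    · rw [image_eq_zero_of_notMem_tsupport hξ, mul_zero]
  ext a
  rw [hsum, pair_sum hβ hf]
  refine Finset.sum_eq_zero fun i _ => ?_
  rw [hrv i (fun h => h0 (h ▸ ht i i.2)) (ψi i) fun ξ hξ => ?_]
  · rfl
  · refine hρ i (subset_tsupport _ ?_)
    rw [Function.mem_support, hψi] at hξ
    exact fun h => hξ (by simp [h])

lemma pair_eq_of_eventuallyEq (hβ : 0 ≤ β) (hf : PolyBounded β f)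
    (hsupp : FourierSupportedAtZero f) {φ ψ : 𝓢(V, ℂ)} (hφ : HasCompactSupport φ)
    (hψ : HasCompactSupport ψ) (h : φ =ᶠ[𝓝 0] ψ) : pair f φ = pair f ψ := by
  have h1 : ⇑(φ - ψ) = ⇑φ - ⇑ψ := rfl
  have := hsupp (φ - ψ) (h1 ▸ hφ.sub hψ) (by
    rw [notMem_tsupport_iff_eventuallyEq, h1]
    filter_upwards [h] with ξ hξ
    simp [hξ])
  ext a
  have h2 := pair_sub hβ hf φ ψ a
  rw [this] at h2
  exact (sub_eq_zero.1 h2.symm)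

lemma corr_fourier_dilate (F : V → ℂ) {κ χ : 𝓢(V, ℂ)} {ε : ℝ} (hε : 0 < ε)
    (h : ∀ ξ, χ ξ = κ (ε⁻¹ • ξ)) (a : V) :
    corr F (𝓕 χ : 𝓢(V, ℂ)) a = ∫ x, F (a + ε⁻¹ • x) * 𝓕 κ x := by
  have h1 := Measure.integral_comp_smul_of_nonneg (volume : Measure V)
    (fun x => F (a + ε⁻¹ • x) * 𝓕 κ x) ε (hR := hε.le)
  have h2 := fourier_dilate_apply (κ := κ) (χ := χ) hε (ξ₀ := 0) (by simpa using h)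
  rw [corr]
  simp_rw [h2, inv_smul_smul₀ hε.ne'] at h1 ⊢
  simp only [inner_zero_left, mul_zero, Complex.ofReal_zero, zero_mul, Complex.exp_zero, one_mul]
  simp_rw [mul_left_comm _ ((ε ^ Module.finrank ℝ V : ℝ) : ℂ)]
  rw [integral_const_mul, h1, ← Complex.real_smul, smul_smul, mul_inv_cancel₀ (by positivity),
    one_smul]

lemma hasCompactSupport_dilate {κ χ : 𝓢(V, ℂ)} (hκ : HasCompactSupport κ) {ε : ℝ} (hε : 0 < ε)
    (h : ∀ ξ, χ ξ = κ (ε⁻¹ • ξ)) : HasCompactSupport χ := by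
  have : ⇑χ = fun ξ => κ (ε⁻¹ • ξ) := funext h
  rw [this]
  exact hκ.comp_smul (inv_ne_zero hε.ne')

lemma eventually_dilate {κ : 𝓢(V, ℂ)} (hκ1 : ∀ᶠ ξ in 𝓝 0, κ ξ = 1) (ε : ℝ) :
    ∀ᶠ ξ in 𝓝 (0 : V), κ (ε⁻¹ • ξ) = 1 :=
  ((continuous_const_smul ε⁻¹).tendsto' (0 : V) 0 (smul_zero _)).eventually hκ1

/-- When the Fourier transform of `f` is supported at the origin, only the germ of `θ` there
matters.  Unlike in the definition, `θ` need not have compact support. -/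
lemma pair_eq_pair_mul_cutoff (hβ : 0 ≤ β) (hf : PolyBounded β f)
    (hsupp : FourierSupportedAtZero f) {κ θ χ : 𝓢(V, ℂ)} (hκ : HasCompactSupport κ)
    (hκ1 : ∀ᶠ ξ in 𝓝 0, κ ξ = 1) (hχ : ∀ ξ, χ ξ = κ ξ * θ ξ) (a : V) :
    pair f θ a = pair f χ a := by
  have hFp := polyBounded_pair hβ hf θ
  obtain ⟨C, hC, hFC⟩ := hFp.exists_bound_add hβ
  have hk := weightedIntegrable_schwartz hβ (𝓕 κ)
  -- Replacing `κ` by its dilate `κ(ε ·)` does not change the pairing, and `κ(ε ·) → 1`.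
  have hconst : ∀ ε : ℝ, 0 < ε → pair f χ a = ∫ y, pair f θ (a + ε • y) * 𝓕 κ y := by
    intro ε hε
    obtain ⟨κ', hκ'⟩ := exists_schwartz_dilate κ (inv_ne_zero hε.ne') 0
    simp only [sub_zero] at hκ'
    obtain ⟨χ', hχ'⟩ := exists_schwartz_mul θ κ'
    have hκ'c := hasCompactSupport_dilate hκ (inv_pos.2 hε) hκ'
    have hχc : HasCompactSupport χ := by
      rw [show ⇑χ = fun ξ => κ ξ * θ ξ from funext hχ]
      exact hκ.mul_right
    have hχ'c : HasCompactSupport χ' := by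
      rw [show ⇑χ' = fun ξ => θ ξ * κ' ξ from funext hχ']
      exact hκ'c.mul_left
    have heq : χ =ᶠ[𝓝 0] χ' := by
      filter_upwards [hκ1, eventually_dilate hκ1 ε⁻¹] with ξ h1 h2
      rw [hχ, hχ', hκ', h1, h2, one_mul, mul_one]
    rw [pair_eq_of_eventuallyEq hβ hf hsupp hχc hχ'c heq, pair_mul hβ hf hχ',
      corr_fourier_dilate _ (inv_pos.2 hε) hκ']
    simp
  have hone : ∫ y, 𝓕 κ y = 1 := by
    have h1 : 𝓕⁻ (𝓕 κ) (0 : V) = κ 0 := by simp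
    rw [SchwartzMap.fourierInv_coe, Real.fourierInv_eq'] at h1
    simpa [hκ1.self_of_nhds] using h1
  have hlim : Tendsto (fun ε : ℝ => ∫ y, pair f θ (a + ε • y) * 𝓕 κ y) (𝓝[>] 0)
      (𝓝 (∫ y, pair f θ a * 𝓕 κ y)) := by
    refine tendsto_integral_filter_of_dominated_convergence
      (fun y => C * polyWeight β a * (polyWeight β y * ‖𝓕 κ y‖)) ?_ ?_
      (hk.integrable_mul.const_mul _) ?_
    · exact Eventually.of_forall fun ε =>
        (((continuous_pair hβ hf θ).comp (by fun_prop)).mul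
          (𝓕 κ : 𝓢(V, ℂ)).continuous).aestronglyMeasurable
    · filter_upwards [Ioc_mem_nhdsGT (zero_lt_one' ℝ)] with ε hε
      refine Eventually.of_forall fun y => ?_
      rw [norm_mul, ← mul_assoc]
      have := polyWeight_nonneg β a
      gcongr
      exact (hFC _ _).trans (by
        gcongr
        exact polyWeight_smul_le_polyWeight hβ hε.1.le hε.2 y)
    · refine Eventually.of_forall fun y => Tendsto.mul_const _ ?_
      refine Tendsto.mono_left ?_ nhdsWithin_le_nhds
      exact ((continuous_pair hβ hf θ).comp (by fun_prop)).tendsto' (0 : ℝ) _ (by simp)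
  rw [integral_const_mul, hone, mul_one] at hlim
  refine tendsto_nhds_unique hlim (tendsto_const_nhds.congr' ?_)
  filter_upwards [self_mem_nhdsWithin] with ε hε
  exact hconst ε hε

lemma PolyBounded.locallyIntegrable (hf : PolyBounded β f) : LocallyIntegrable f := by
  obtain ⟨C, hC, h⟩ := hf.exists_bound
  refine (((continuous_polyWeight β).const_mul C).locallyIntegrable (μ := volume)).mono
    hf.measurable.aestronglyMeasurable (Eventually.of_forall fun x => ?_)
  exact (h x).trans (le_abs_self _)

/-- A function whose Fourier transform is supported at the origin agrees almost everywhere with the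
smooth function obtained by cutting off its Fourier transform near the origin. -/
lemma ae_eq_pair_cutoff (hβ : 0 ≤ β) (hf : PolyBounded β f)
    (hsupp : FourierSupportedAtZero f) {κ : 𝓢(V, ℂ)} (hκ : HasCompactSupport κ)
    (hκ1 : ∀ᶠ ξ in 𝓝 0, κ ξ = 1) : f =ᵐ[volume] pair f κ := by
  refine ae_eq_of_integral_contDiff_smul_eq hf.locallyIntegrable
    (polyBounded_pair hβ hf κ).locallyIntegrable fun g hg hgc => ?_
  obtain ⟨θ, hθ⟩ := exists_fourier_eq_ofReal hg hgc
  obtain ⟨χ, hχ⟩ := exists_schwartz_mul κ θ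
  have h := pair_eq_pair_mul_cutoff hβ hf hsupp hκ hκ1 hχ 0
  rw [pair_mul hβ hf hχ, pair_apply, corr] at h
  simp_rw [hθ, zero_add] at h
  simpa [mul_comm] using h

/-! ### Vanishing of high derivatives -/

lemma foldr_coordMul_apply (l : List V) (ψ : 𝓢(V, ℂ)) (ξ : V) :
    l.foldr coordMul ψ ξ =
      (l.map fun v => 2 * Real.pi * Complex.I * ((inner ℝ ξ v : ℝ) : ℂ)).prod * ψ ξ := by
  induction l with
  | nil => simp
  | cons v l ih => rw [List.foldr_cons, coordMul_apply, ih, List.map_cons, List.prod_cons]; ring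

lemma prod_inner_smul (l : List V) (ε : ℝ) (ξ : V) :
    (l.map fun v => 2 * Real.pi * Complex.I * ((inner ℝ (ε • ξ) v : ℝ) : ℂ)).prod =
      (ε : ℂ) ^ l.length *
        (l.map fun v => 2 * Real.pi * Complex.I * ((inner ℝ ξ v : ℝ) : ℂ)).prod := by
  induction l with
  | nil => simp
  | cons v l ih =>
    rw [List.map_cons, List.prod_cons, ih, List.map_cons, List.prod_cons, List.length_cons,
      real_inner_smul_left]
    push_cast
    ring

/-- The derivatives of order greater than `β` of the cut-off function vanish: cutting off at
frequency `ε` instead multiplies their size by `ε ^ (|l| - β)`. -/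
lemma pair_foldr_coordMul_eq_zero (hβ : 0 ≤ β) (hf : PolyBounded β f)
    (hsupp : FourierSupportedAtZero f) {κ : 𝓢(V, ℂ)} (hκ : HasCompactSupport κ)
    (hκ1 : ∀ᶠ ξ in 𝓝 0, κ ξ = 1) {l : List V} (hl : β < l.length) :
    pair f (l.foldr coordMul κ) = 0 := by
  set θ := l.foldr coordMul κ with hθ
  obtain ⟨C, hC, hfC⟩ := hf.exists_bound_add hβ
  have hk := weightedIntegrable_schwartz hβ (𝓕 θ)
  have hcompact : ∀ {ψ : 𝓢(V, ℂ)}, HasCompactSupport ψ →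
      HasCompactSupport (l.foldr coordMul ψ : 𝓢(V, ℂ)) := fun {ψ} hψ => by
    rw [show ⇑(l.foldr coordMul ψ : 𝓢(V, ℂ)) = _ from funext (foldr_coordMul_apply l ψ)]
    exact hψ.mul_left
  ext a
  set A := C * polyWeight β a * ∫ x, polyWeight β x * ‖𝓕 θ x‖ with hA
  have hbound : ∀ ε : ℝ, 0 < ε → ε ≤ 1 → ‖pair f θ a‖ ≤ A * ε ^ (l.length - β) := by
    intro ε hε hε1
    obtain ⟨χ, hχ⟩ := exists_schwartz_dilate κ hε.ne' 0
    obtain ⟨τ, hτ⟩ := exists_schwartz_dilate θ hε.ne' 0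
    simp only [sub_zero] at hχ hτ
    have h1 : pair f θ = pair f (l.foldr coordMul χ) := by
      refine pair_eq_of_eventuallyEq hβ hf hsupp (hcompact hκ)
        (hcompact (hasCompactSupport_dilate hκ hε hχ)) ?_
      filter_upwards [hκ1, eventually_dilate hκ1 ε] with ξ h1 h2
      rw [foldr_coordMul_apply, foldr_coordMul_apply, hχ, h1, h2]
    have h2 : l.foldr coordMul χ = ((ε : ℂ) ^ l.length) • τ := by
      ext ξ
      have h3 := prod_inner_smul l ε (ε⁻¹ • ξ)
      rw [smul_inv_smul₀ hε.ne'] at h3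
      rw [foldr_coordMul_apply, smul_apply, hτ, hθ, foldr_coordMul_apply, hχ, h3,
        smul_eq_mul, mul_assoc]
    have h3 : pair f (l.foldr coordMul χ) a = (ε : ℂ) ^ l.length * pair f τ a := by
      rw [h2, pair_apply, pair_apply, ← integral_const_mul, FourierTransform.fourier_smul]
      congr 1
      ext x
      rw [smul_apply, smul_eq_mul]
      ring
    have h4 : ‖pair f τ a‖ ≤ ε⁻¹ ^ β * A := by
      rw [pair, corr_fourier_dilate f hε hτ, hA, ← integral_const_mul, ← integral_const_mul]
      refine norm_integral_le_of_norm_le ((hk.integrable_mul.const_mul _).const_mul _)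
        (Eventually.of_forall fun x => ?_)
      have hpa := polyWeight_nonneg β a
      rw [norm_mul]
      calc _ ≤ C * polyWeight β a * (ε⁻¹ ^ β * polyWeight β x) * ‖𝓕 θ x‖ := by
            gcongr
            exact (hfC _ _).trans (by
              gcongr
              exact polyWeight_smul_le hβ ((one_le_inv₀ hε).2 hε1) x)
        _ = _ := by ring
    rw [h1, h3, norm_mul, norm_pow, Complex.norm_real, Real.norm_of_nonneg hε.le]
    calc _ ≤ ε ^ l.length * (ε⁻¹ ^ β * A) := by gcongr
      _ = _ := by
        rw [Real.rpow_sub hε, Real.rpow_natCast, Real.inv_rpow hε.le]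
        ring
  have hlim : Tendsto (fun ε : ℝ => A * ε ^ (l.length - β)) (𝓝[>] 0) (𝓝 0) := by
    have h1 : Tendsto (fun ε : ℝ => ε ^ (l.length - β)) (𝓝 0) (𝓝 0) := by
      have := (Real.continuous_rpow_const (sub_pos.2 hl).le).tendsto (0 : ℝ)
      rwa [Real.zero_rpow (sub_pos.2 hl).ne'] at this
    simpa using (h1.mono_left nhdsWithin_le_nhds).const_mul A
  have h0 : ‖pair f θ a‖ ≤ 0 := by
    refine ge_of_tendsto hlim ?_
    filter_upwards [Ioc_mem_nhdsGT (zero_lt_one' ℝ)] with ε hε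
    exact hbound ε hε.1 hε.2
  simpa using h0

end General

/-! ### Functions with polynomial partial derivatives -/

section Polynomial

variable {n : ℕ}

/-- The polynomial `∫₀¹ p(tx) dt`, obtained by dividing each coefficient by its degree plus one. -/
def radialMean (p : MvPolynomial (Fin n) ℂ) : MvPolynomial (Fin n) ℂ :=
  ∑ s ∈ p.support, MvPolynomial.monomial s (p.coeff s / (s.degree + 1 : ℂ))

lemma totalDegree_radialMean_le (p : MvPolynomial (Fin n) ℂ) :
    (radialMean p).totalDegree ≤ p.totalDegree := by
  refine MvPolynomial.totalDegree_finsetSum_le fun s hs => ?_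
  refine (MvPolynomial.totalDegree_monomial_le _ _).trans ?_
  exact MvPolynomial.le_totalDegree hs

lemma polyFun_monomial_smul (s : Fin n →₀ ℕ) (c : ℂ) (t : ℝ) (x : Rn n) :
    polyFun (MvPolynomial.monomial s c) (t • x) =
      (t : ℂ) ^ s.degree * polyFun (MvPolynomial.monomial s c) x := by
  simp only [polyFun, MvPolynomial.eval_monomial, PiLp.smul_apply, smul_eq_mul, Complex.ofReal_mul,
    mul_pow, Finsupp.prod, Finset.prod_mul_distrib, Finset.prod_pow_eq_pow_sum,
    Finsupp.degree_apply]
  ring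

lemma polyFun_sum {ι : Type*} (s : Finset ι) (p : ι → MvPolynomial (Fin n) ℂ) (x : Rn n) :
    polyFun (∑ i ∈ s, p i) x = ∑ i ∈ s, polyFun (p i) x := by
  simp [polyFun]

lemma hasDerivAt_mul_radialMean (p : MvPolynomial (Fin n) ℂ) (x : Rn n) (t : ℝ) :
    HasDerivAt (fun t : ℝ => (t : ℂ) * polyFun (radialMean p) (t • x)) (polyFun p (t • x)) t := by
  have h1 : ∀ t : ℝ, (t : ℂ) * polyFun (radialMean p) (t • x) = ∑ s ∈ p.support,
      (t : ℂ) ^ (s.degree + 1) *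
        polyFun (MvPolynomial.monomial s (p.coeff s / (s.degree + 1 : ℂ))) x := fun t => by
    rw [radialMean, polyFun_sum, Finset.mul_sum]
    refine Finset.sum_congr rfl fun s _ => ?_
    rw [polyFun_monomial_smul]
    ring
  have h2 : polyFun p (t • x) = ∑ s ∈ p.support,
      ((s.degree + 1 : ℕ) * (t : ℂ) ^ s.degree) *
        polyFun (MvPolynomial.monomial s (p.coeff s / (s.degree + 1 : ℂ))) x := by
    conv_lhs => rw [p.as_sum, polyFun_sum]
    refine Finset.sum_congr rfl fun s _ => ?_
    rw [polyFun_monomial_smul]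
    have : (s.degree : ℂ) + 1 ≠ 0 := Nat.cast_add_one_ne_zero s.degree
    simp only [polyFun, MvPolynomial.eval_monomial]
    push_cast
    field_simp
  simp_rw [h1, h2]
  refine HasDerivAt.fun_sum fun s _ => HasDerivAt.mul_const ?_ _
  simpa using (hasDerivAt_pow (s.degree + 1) (t : ℂ)).comp_ofReal

/-- A function whose partial derivatives are polynomials is a polynomial, of degree at most one
more. -/
lemma exists_eq_polyFun_of_hasFDerivAt {F : Rn n → ℂ} {d : ℕ} {p : Fin n → MvPolynomial (Fin n) ℂ}
    (hp : ∀ i, (p i).totalDegree ≤ d)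
    (hF : ∀ x, ∃ D : Rn n →L[ℝ] ℂ, HasFDerivAt F D x ∧
      ∀ i, D (EuclideanSpace.single i 1) = polyFun (p i) x) :
    ∃ q : MvPolynomial (Fin n) ℂ, q.totalDegree ≤ d + 1 ∧ F = polyFun q := by
  refine ⟨MvPolynomial.C (F 0) + ∑ i, MvPolynomial.X i * radialMean (p i), ?_, ?_⟩
  · refine (MvPolynomial.totalDegree_add _ _).trans (max_le (by simp) ?_)
    refine MvPolynomial.totalDegree_finsetSum_le fun i _ => ?_
    refine (MvPolynomial.totalDegree_mul _ _).trans ?_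
    rw [MvPolynomial.totalDegree_X, add_comm]
    exact Nat.add_le_add_right ((totalDegree_radialMean_le _).trans (hp i)) 1
  · ext x
    set G : ℝ → ℂ := fun t =>
      F (t • x) - ∑ i, ((x i : ℝ) : ℂ) * ((t : ℂ) * polyFun (radialMean (p i)) (t • x)) with hG
    have hG' : ∀ t, HasDerivAt G 0 t := by
      intro t
      obtain ⟨D, hD, hDi⟩ := hF (t • x)
      have hx : x = ∑ i, x i • EuclideanSpace.single i (1 : ℝ) := by
        simpa using ((EuclideanSpace.basisFun (Fin n) ℝ).sum_repr x).symm
      have h1 : HasDerivAt (fun t : ℝ => F (t • x)) (D x) t := by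
        have := hD.comp_hasDerivAt t ((hasDerivAt_id t).smul_const x)
        simpa [Function.comp_def] using this
      have h2 : D x = ∑ i, ((x i : ℝ) : ℂ) * polyFun (p i) (t • x) := by
        conv_lhs => rw [hx, map_sum]
        refine Finset.sum_congr rfl fun i _ => ?_
        rw [map_smul, hDi, Complex.real_smul]
      have h3 := h1.sub (HasDerivAt.fun_sum fun i (_ : i ∈ Finset.univ) =>
        (hasDerivAt_mul_radialMean (p i) x t).const_mul ((x i : ℝ) : ℂ))
      rw [h2, sub_self] at h3
      exact h3
    have hconst := is_const_of_deriv_eq_zero (fun t => (hG' t).differentiableAt)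
      (fun t => (hG' t).deriv) 1 0
    simp only [hG, one_smul, zero_smul, Complex.ofReal_one, Complex.ofReal_zero, one_mul, zero_mul,
      mul_zero, Finset.sum_const_zero, sub_zero] at hconst
    rw [sub_eq_iff_eq_add] at hconst
    rw [hconst]
    simp [polyFun]

end Polynomial

/-- If all derivatives of order `d + 1` of `pair f ψ` vanish, then it is a polynomial of degree at
most `d`. -/
lemma exists_pair_eq_polyFun {n : ℕ} {β : ℝ} {f : Rn n → ℂ} (hβ : 0 ≤ β) (hf : PolyBounded β f)
    (d : ℕ) (ψ : 𝓢(Rn n, ℂ))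
    (h : ∀ l : List (Rn n), l.length = d + 1 → pair f (l.foldr coordMul ψ) = 0) :
    ∃ q : MvPolynomial (Fin n) ℂ, q.totalDegree ≤ d ∧ pair f ψ = polyFun q := by
  induction d generalizing ψ with
  | zero =>
    refine ⟨MvPolynomial.C (pair f ψ 0), by simp, ?_⟩
    have hD : ∀ a, HasFDerivAt (pair f ψ) (0 : Rn n →L[ℝ] ℂ) a := fun a => by
      obtain ⟨D, hD, hDv⟩ := hasFDerivAt_pair hβ hf ψ a
      refine hD.congr_fderiv (ContinuousLinearMap.ext fun v => ?_)
      have := h [v] rfl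
      simp only [List.foldr_cons, List.foldr_nil] at this
      rw [hDv, this]
      rfl
    ext a
    rw [is_const_of_fderiv_eq_zero (fun a => (hD a).differentiableAt) (fun a => (hD a).fderiv) a 0]
    simp [polyFun]
  | succ d ih =>
    have h' : ∀ i : Fin n, ∃ q : MvPolynomial (Fin n) ℂ, q.totalDegree ≤ d ∧
        pair f (coordMul (EuclideanSpace.single i 1) ψ) = polyFun q := fun i => by
      refine ih _ fun l hl => ?_
      have := h (l ++ [EuclideanSpace.single i 1]) (by simp [hl])
      simpa using this
    choose p hp hpq using h'
    refine exists_eq_polyFun_of_hasFDerivAt hp fun x => ?_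
    obtain ⟨D, hD, hDv⟩ := hasFDerivAt_pair hβ hf ψ x
    exact ⟨D, hD, fun i => by rw [hDv, hpq]⟩

/-- A polynomially bounded function whose Fourier transform is supported at the origin is a
polynomial of degree at most its order of growth. -/
theorem exists_ae_eq_polyFun_of_fourierSupportedAtZero {n : ℕ} {β : ℝ} {f : Rn n → ℂ} (hβ : 0 ≤ β)
    (hf : PolyBounded β f) (hsupp : FourierSupportedAtZero f) :
    ∃ q : MvPolynomial (Fin n) ℂ, q.totalDegree ≤ ⌊β⌋₊ ∧ f =ᵐ[volume] polyFun q := by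
  obtain ⟨κ, hκ, ρ, hρ, hκρ⟩ := exists_schwartz_cutoff (Rn n)
  have hκ1 : ∀ᶠ ξ in 𝓝 0, κ ξ = 1 := by
    filter_upwards [Metric.ball_mem_nhds (0 : Rn n) hρ] with ξ hξ
    exact hκρ ξ (by simpa using hξ)
  obtain ⟨q, hq, hqf⟩ := exists_pair_eq_polyFun hβ hf ⌊β⌋₊ κ fun l hl =>
    pair_foldr_coordMul_eq_zero hβ hf hsupp hκ hκ1 (by
      rw [hl]
      exact_mod_cast Nat.lt_floor_add_one β)
  exact ⟨q, hq, hqf ▸ ae_eq_pair_cutoff hβ hf hsupp hκ hκ1⟩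

variable {n : ℕ} {β : ℝ} {f g φ m : Rn n → ℂ}

/-! ### The weights and the Fourier transform of the statement -/

lemma weight_pos (x : Rn n) : 0 < weight x := Real.sqrt_pos.2 (by positivity)

lemma weight_le (x : Rn n) : weight x ≤ 1 + ‖x‖ :=
  Real.sqrt_le_iff.2 ⟨by positivity, by nlinarith [norm_nonneg x]⟩

lemma one_add_norm_le_weight (x : Rn n) : 1 + ‖x‖ ≤ 2 * weight x := by
  have h1 : 1 ≤ weight x := Real.one_le_sqrt.2 (by nlinarith [norm_nonneg x])
  have h2 : ‖x‖ ≤ weight x := Real.le_sqrt_of_sq_le (by linarith)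
  linarith

lemma MemL1Weight.weightedIntegrable (hβ : 0 ≤ β) (hg : MemL1Weight β g) :
    WeightedIntegrable β g := by
  refine ⟨hg.1.aestronglyMeasurable, (hg.2.const_mul (2 ^ β)).mono'
    ((continuous_polyWeight β).aestronglyMeasurable.mul hg.1.aestronglyMeasurable.norm)
    (Eventually.of_forall fun x => ?_)⟩
  rw [Real.norm_of_nonneg (mul_nonneg (polyWeight_nonneg β x) (norm_nonneg _))]
  have h : polyWeight β x ≤ 2 ^ β * weight x ^ β := by
    rw [← Real.mul_rpow (by norm_num) (weight_pos x).le]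
    exact Real.rpow_le_rpow (by positivity) (one_add_norm_le_weight x) hβ
  calc polyWeight β x * ‖g x‖ ≤ (2 ^ β * weight x ^ β) * ‖g x‖ := by gcongr
    _ = _ := by ring

lemma MemLinftyWeight.exists_polyBounded (hβ : 0 ≤ β) (hf : MemLinftyWeight β f) :
    ∃ f', PolyBounded β f' ∧ f =ᵐ[volume] f' := by
  obtain ⟨hm, hL⟩ := hf
  set C : ℝ := (eLpNormEssSup (fun x : Rn n => ((weight x ^ (-β) : ℝ) : ℂ) * f x) volume).toReal
  have hfin : eLpNormEssSup (fun x : Rn n => ((weight x ^ (-β) : ℝ) : ℂ) * f x) volume ≠ ⊤ := by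
    have := hL.eLpNorm_lt_top
    rw [eLpNorm_exponent_top] at this
    exact this.ne
  have hC : 0 ≤ C := ENNReal.toReal_nonneg
  have hb : ∀ᵐ x, ‖f x‖ ≤ C * polyWeight β x := by
    filter_upwards [ae_le_eLpNormEssSup (μ := (volume : Measure (Rn n)))
      (f := fun x : Rn n => ((weight x ^ (-β) : ℝ) : ℂ) * f x)] with x hx
    have h1 := (ENNReal.toReal_le_toReal enorm_ne_top hfin).2 hx
    have hw := weight_pos x
    rw [toReal_enorm, norm_mul, Complex.norm_real, Real.norm_of_nonneg (by positivity),
      Real.rpow_neg hw.le, inv_mul_le_iff₀ (by positivity), mul_comm] at h1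
    refine h1.trans ?_
    gcongr
    exact Real.rpow_le_rpow hw.le (weight_le x) hβ
  set f₀ := hm.mk f with hf₀
  have hf₀m : Measurable f₀ := hm.stronglyMeasurable_mk.measurable
  refine ⟨{x | ‖f₀ x‖ ≤ C * polyWeight β x}.indicator f₀, ⟨?_, C, hC, fun x => ?_⟩, ?_⟩
  · exact hf₀m.indicator (measurableSet_le hf₀m.norm
      ((continuous_polyWeight β).measurable.const_mul C))
  · by_cases hx : ‖f₀ x‖ ≤ C * polyWeight β x
    · rwa [Set.indicator_of_mem (by exact hx)]
    · rw [Set.indicator_of_notMem (by exact hx), norm_zero]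
      exact mul_nonneg hC (polyWeight_nonneg β x)
  · filter_upwards [hb, hm.ae_eq_mk] with x hx hx'
    have : x ∈ {x | ‖f₀ x‖ ≤ C * polyWeight β x} := by
      rw [Set.mem_ofPred_eq, hf₀, ← hx']
      exact hx
    rw [Set.indicator_of_mem this, hx']

lemma fourierT_eq (g : Rn n → ℂ) (ξ : Rn n) :
    fourierT g ξ = (((2 * Real.pi) ^ n)⁻¹ : ℝ) * 𝓕 g ((2 * Real.pi)⁻¹ • ξ) := by
  rw [fourierT, Real.fourier_eq']
  congr 2
  ext x
  rw [smul_eq_mul, real_inner_smul_right]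
  congr 2
  have : (Real.pi : ℂ) ≠ 0 := by exact_mod_cast Real.pi_ne_zero
  push_cast
  field_simp

lemma integral_exp_mul_eq (g : Rn n → ℂ) (ξ : Rn n) :
    ∫ x, Complex.exp (((2 * Real.pi * inner ℝ ξ x : ℝ) : ℂ) * Complex.I) * g x =
      ((2 * Real.pi) ^ n : ℝ) * fourierT g (-(2 * Real.pi) • ξ) := by
  rw [fourierT, ← mul_assoc, ← Complex.ofReal_mul, mul_inv_cancel₀ (by positivity),
    Complex.ofReal_one, one_mul]
  congr 1
  ext x
  congr 2
  rw [real_inner_smul_right, real_inner_comm]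
  push_cast
  ring

/-- The Fourier transform is injective on `L¹`. -/
lemma ae_eq_of_fourierT_eq {g₁ g₂ : Rn n → ℂ} (h₁ : Integrable g₁) (h₂ : Integrable g₂)
    (h : ∀ ξ, fourierT g₁ ξ = fourierT g₂ ξ) : g₁ =ᵐ[volume] g₂ := by
  have hF : ∀ ξ, 𝓕 g₁ ξ = 𝓕 g₂ ξ := fun ξ => by
    have := h ((2 * Real.pi) • ξ)
    rw [fourierT_eq, fourierT_eq, inv_smul_smul₀ (by positivity)] at this
    exact mul_left_cancel₀ (Complex.ofReal_ne_zero.2 (by positivity)) this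
  refine ae_eq_of_integral_contDiff_smul_eq h₁.locallyIntegrable h₂.locallyIntegrable
    fun γ hγ hγc => ?_
  obtain ⟨θ, hθ⟩ := exists_fourier_eq_ofReal hγ hγc
  have key : ∀ {g : Rn n → ℂ}, Integrable g → ∫ x, γ x • g x = ∫ x, θ x * 𝓕 g x := by
    intro g hg
    have := VectorFourier.integral_fourierIntegral_smul_eq_flip (μ := (volume : Measure (Rn n)))
      (ν := (volume : Measure (Rn n))) (L := innerₗ (Rn n)) (f := θ) (g := g)
      Real.continuous_fourierChar continuous_inner θ.integrable hg
    rw [flip_innerₗ] at this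
    calc ∫ x, γ x • g x = ∫ x, 𝓕 θ x • g x := by
          simp_rw [hθ, Complex.real_smul, smul_eq_mul]
      _ = _ := this
  rw [key h₁, key h₂]
  simp_rw [hF]

/-! ### Weak solutions annihilate translates -/

lemma fourierT_comp_sub (g : Rn n → ℂ) (a ξ : Rn n) :
    fourierT (fun x => g (x - a)) ξ =
      Complex.exp (-(Complex.I * ((inner ℝ a ξ : ℝ) : ℂ))) * fourierT g ξ := by
  rw [fourierT, fourierT, mul_left_comm]
  congr 1
  rw [← integral_const_mul, ← integral_add_right_eq_self _ a]
  congr 1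
  ext x
  rw [add_sub_cancel_right, ← mul_assoc, ← Complex.exp_add, inner_add_left]
  congr 2
  push_cast
  ring

lemma IsTestFunction.comp_sub (hφ : IsTestFunction φ) (a : Rn n) :
    IsTestFunction fun x => φ (x - a) :=
  ⟨hφ.1.comp (contDiff_id.sub contDiff_const),
    hφ.2.comp_homeomorph (Homeomorph.subRight a)⟩

/-- By uniqueness of the Fourier transform, the multiplier image of a translate of `φ` is the
translate of the multiplier image `g`, hence `f` annihilates all translates of `g`. -/
lemma IsWeakSolution.corr_eq_zero (hf : IsWeakSolution m f) (hφ : IsTestFunction φ)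
    (hg : IsMultiplierImage (reflect m) φ g) (a : Rn n) : corr f g a = 0 := by
  obtain ⟨g', ⟨hg'i, hg'⟩, -, hint⟩ := hf _ (hφ.comp_sub a)
  have hae : g' =ᵐ[volume] fun x => g (x - a) := by
    refine ae_eq_of_fourierT_eq hg'i (hg.1.comp_sub_right a) fun ξ => ?_
    rw [hg', fourierT_comp_sub, fourierT_comp_sub, hg.2]
    ring
  rw [corr, ← integral_sub_right_eq_self _ a, ← hint]
  refine integral_congr_ae ?_
  filter_upwards [hae] with x hx
  rw [hx, add_sub_cancel]

/-- For every nonzero frequency some element of the range of `m̃(D)` has a Fourier transform that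
does not vanish there. -/
lemma exists_isMultiplierImage_ne_zero (hm : {η : Rn n | m η = 0} ⊆ {0})
    (hmap : MapsTestFunctionsIntoL1Weight β (reflect m)) {ξ₀ : Rn n} (hξ₀ : ξ₀ ≠ 0) :
    ∃ φ g, IsTestFunction φ ∧ IsMultiplierImage (reflect m) φ g ∧ MemL1Weight β g ∧
      ∫ y, Complex.exp (((2 * Real.pi * inner ℝ ξ₀ y : ℝ) : ℂ) * Complex.I) * g y ≠ 0 := by
  obtain ⟨b⟩ : Nonempty (ContDiffBump (0 : Rn n)) := inferInstance
  set φ : Rn n → ℂ := fun x =>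
    Complex.exp (-(((2 * Real.pi * inner ℝ ξ₀ x : ℝ) : ℂ) * Complex.I)) * ((b x : ℝ) : ℂ) with hφ
  have hφt : IsTestFunction φ := by
    refine ⟨ContDiff.mul (ContDiff.cexp ?_) (Complex.ofRealCLM.contDiff.comp b.contDiff),
      (b.hasCompactSupport.comp_left Complex.ofReal_zero).mul_left⟩
    refine (ContDiff.mul (Complex.ofRealCLM.contDiff.comp ?_) contDiff_const).neg
    exact contDiff_const.mul (contDiff_const.inner ℝ contDiff_id)
  obtain ⟨g, hg, hgw⟩ := hmap φ hφt
  refine ⟨φ, g, hφt, hg, hgw, ?_⟩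
  rw [integral_exp_mul_eq, hg.2, mul_left_comm, ← integral_exp_mul_eq, reflect]
  refine mul_ne_zero (fun h => ?_) ?_
  · have : -(-(2 * Real.pi) • ξ₀) = 0 := hm h
    rw [neg_smul, neg_neg, smul_eq_zero] at this
    exact this.elim (by positivity) hξ₀
  · have h1 : ∀ y, Complex.exp (((2 * Real.pi * inner ℝ ξ₀ y : ℝ) : ℂ) * Complex.I) * φ y =
        ((b y : ℝ) : ℂ) := fun y => by
      rw [hφ, ← mul_assoc, ← Complex.exp_add, add_neg_cancel, Complex.exp_zero, one_mul]
    simp_rw [h1]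
    rw [integral_complex_ofReal]
    exact Complex.ofReal_ne_zero.2 b.integral_pos.ne'

/-- If the symbol has no zero apart from the origin, then weak solutions are polynomials: the local
Wiener lemma applies at every nonzero frequency, so the Fourier transform lives at the origin. -/
theorem IsWeakSolution.exists_ae_eq_polyFun (hβ : 0 ≤ β)
    (hmap : MapsTestFunctionsIntoL1Weight β (reflect m)) (hm : {η : Rn n | m η = 0} ⊆ {0})
    (hfb : MemLinftyWeight β f) (hf : IsWeakSolution m f) :
    ∃ p : MvPolynomial (Fin n) ℂ, p.totalDegree ≤ ⌊β⌋₊ ∧ f =ᵐ[volume] polyFun p := by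
  obtain ⟨f', hf', hff'⟩ := hfb.exists_polyBounded hβ
  have hsupp : FourierSupportedAtZero f' := by
    refine fourierSupportedAtZero_of_local hβ hf' fun ξ₀ hξ₀ => ?_
    obtain ⟨φ, g, hφ, hg, hgw, hne⟩ := exists_isMultiplierImage_ne_zero hm hmap hξ₀
    refine exists_pair_eq_zero_of_support_subset hβ hf' (hgw.weightedIntegrable hβ) (fun a => ?_)
      hne
    rw [← hf.corr_eq_zero hφ hg a]
    refine integral_congr_ae ?_
    filter_upwards [(measurePreserving_add_left volume a).quasiMeasurePreserving.ae hff'] with x hx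
    rw [hx]
  obtain ⟨p, hp, hfp⟩ := exists_ae_eq_polyFun_of_fourierSupportedAtZero hβ hf' hsupp
  exact ⟨p, hp, hff'.trans hfp⟩

/-! ### Plane waves -/

/-- The plane wave of frequency `η` is a bounded weak solution when the symbol vanishes at `η`. -/
lemma isWeakSolution_exp (hmap : MapsTestFunctionsIntoL1Weight β (reflect m)) {η : Rn n}
    (hη : m η = 0) :
    IsWeakSolution m fun x => Complex.exp (((inner ℝ η x : ℝ) : ℂ) * Complex.I) := by
  intro φ hφ
  obtain ⟨g, hg, -⟩ := hmap φ hφ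
  refine ⟨g, hg, ?_, ?_⟩
  · exact hg.1.bdd_mul (c := 1) (by fun_prop : Continuous _).aestronglyMeasurable
      (Eventually.of_forall fun x => (Complex.norm_exp_ofReal_mul_I _).le)
  · have h := integral_exp_mul_eq g ((2 * Real.pi)⁻¹ • η)
    rw [hg.2, neg_smul, smul_inv_smul₀ (by positivity), reflect, neg_neg, hη, zero_mul,
      mul_zero] at h
    rw [← h]
    congr 1
    ext x
    rw [real_inner_smul_left, mul_inv_cancel_left₀ (by positivity)]

/-- A plane wave of nonzero frequency is not a polynomial: on a line along the frequency it takes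
the value `1` infinitely often without being constant. -/
lemma exp_inner_ne_polyFun {η : Rn n} (hη : η ≠ 0) (p : MvPolynomial (Fin n) ℂ) :
    (fun x : Rn n => Complex.exp (((inner ℝ η x : ℝ) : ℂ) * Complex.I)) ≠ polyFun p := by
  intro h
  set q : Polynomial ℂ :=
    MvPolynomial.aeval (fun i => Polynomial.C ((η i : ℝ) : ℂ) * Polynomial.X) p
    with hqdef
  have hn : 0 < ‖η‖ ^ 2 := by positivity
  have hq : ∀ t : ℝ, q.eval (((t / ‖η‖ ^ 2 : ℝ)) : ℂ) = Complex.exp ((t : ℂ) * Complex.I) := by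
    intro t
    have h1 := congrFun h ((t / ‖η‖ ^ 2) • η)
    simp only [real_inner_smul_right, real_inner_self_eq_norm_sq] at h1
    rw [div_mul_cancel₀ _ hn.ne'] at h1
    have h2 : (Polynomial.aeval (((t / ‖η‖ ^ 2 : ℝ)) : ℂ)) q = polyFun p ((t / ‖η‖ ^ 2) • η) := by
      rw [hqdef, ← AlgHom.comp_apply, MvPolynomial.comp_aeval]
      refine congrArg (fun v => MvPolynomial.eval v p) (funext fun i => ?_)
      rw [map_mul, Polynomial.aeval_C, Polynomial.aeval_X, PiLp.smul_apply, smul_eq_mul,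
        Complex.ofReal_mul, mul_comm]
      rfl
    rw [h1, ← h2, Polynomial.coe_aeval_eq_eval]
  have hinf : q = 1 := by
    refine Polynomial.eq_of_infinite_eval_eq _ _ (Set.infinite_of_injective_forall_mem
      (f := fun k : ℕ => (((2 * Real.pi * k / ‖η‖ ^ 2 : ℝ)) : ℂ)) ?_ fun k => ?_)
    · intro j k hjk
      have h1 := Complex.ofReal_injective hjk
      rw [div_left_inj' hn.ne'] at h1
      exact_mod_cast mul_left_cancel₀ (by positivity) h1
    · rw [Set.mem_ofPred_eq, hq, Polynomial.eval_one, Complex.exp_eq_one_iff]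
      exact ⟨k, by push_cast; ring⟩
  have h2 := hq Real.pi
  rw [hinf, Polynomial.eval_one, Complex.exp_pi_mul_I] at h2
  norm_num at h2

end Liouville

end

theorem theorem2p2 (n : ℕ) (β : ℝ) (hβ : 0 ≤ β) (m : Liouville.Rn n → ℂ) (hm : Continuous m)
    (hmap : Liouville.MapsTestFunctionsIntoL1Weight β (Liouville.reflect m)) :
    ({η : Liouville.Rn n | m η = 0} ⊆ {0} →
      ∀ f : Liouville.Rn n → ℂ, Liouville.MemLinftyWeight β f → Liouville.IsWeakSolution m f →
        ∃ p : MvPolynomial (Fin n) ℂ, p.totalDegree ≤ ⌊β⌋₊ ∧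
          f =ᵐ[MeasureTheory.volume] Liouville.polyFun p) ∧
    ((∀ f : Liouville.Rn n → ℂ, MeasureTheory.MemLp f ⊤ MeasureTheory.volume →
        Liouville.IsWeakSolution m f →
        ∃ p : MvPolynomial (Fin n) ℂ, f =ᵐ[MeasureTheory.volume] Liouville.polyFun p) →
      {η : Liouville.Rn n | m η = 0} ⊆ {0}) := by
  refine ⟨fun hz f hfb hf => hf.exists_ae_eq_polyFun hβ hmap hz hfb, fun h η hη => ?_⟩
  by_contra hne
  have hc : Continuous fun x : Liouville.Rn n =>
      Complex.exp (((inner ℝ η x : ℝ) : ℂ) * Complex.I) := by fun_prop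
  obtain ⟨p, hp⟩ := h _
    (memLp_top_of_bound hc.aestronglyMeasurable 1
      (Filter.Eventually.of_forall fun x => (Complex.norm_exp_ofReal_mul_I _).le))
    (Liouville.isWeakSolution_exp hmap hη)
  have hpc : Continuous (Liouville.polyFun p) :=
    (MvPolynomial.continuous_eval p).comp (by fun_prop)
  exact Liouville.exp_inner_ne_polyFun hne p (hc.ae_eq_iff_eq volume hpc |>.1 hp)
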